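/- Let $I\subset\mathbb R$ be an interval (of finite or infinite length), let $\mathfrak F=\bigoplus_{n\ge 0}L^2(I)^{\odot n}$ be the bosonic Fock space over $L^2(I)$ with vacuum $|\Omega\rangle$, and let $\psi(x),\psi^\dagger(x)$ be the bosonic field operators, $[\psi(x),\psi^\dagger(y)]=\delta(x-y)$, $\psi(x)|\Omega\rangle=0$. Path-ordered exponentials $\mathcal P e^{\int_I G(x)\,dx}$ are understood as Dyson series $\sum_{m\ge0}\int_{x_1<\dots<x_m}G(x_1)\cdots G(x_m)\,dx_1\cdots dx_m$, evaluated in matrix elements $\langle\Psi|\cdot|\Phi\rangle$ with finite-particle vectors $\Psi$ on the left. For $B\in M_D(\mathbb C)$ and $Q,L:I\to M_D(\mathbb C)$ with $Q\in L^1(I)$, $L\in L^2(I)$, the continuous matrix product state (cMPS) of bond dimension $D$ with tensors $(B,Q,L)$ is $$|\psi[B,Q,L]\rangle=\operatorname{Tr}_D\Big(B\,\mathcal P e^{\int_I dx\,(Q(x)\otimes 1+L(x)\otimes\psi^\dagger(x))}\Big)|\Omega\rangle .$$ For, in addition, $R:I\to M_D(\mathbb C)$ in $L^2(I)$ and $T:I\to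 M_D(\mathbb C)$ in $L^\infty(I)$, the continuous matrix product operator (cMPO) of bond dimension $D$ is the (in general unbounded) operator on $\mathfrak F$, with its natural domain, $$O[B,Q,L,R,T]=\operatorname{Tr}_D\Big(B\,\mathcal P e^{\int_I dx\,\mathfrak L_x}\Big)(|\Omega\rangle\langle\Omega|),\qquad \mathfrak L_x=Q(x)\otimes\mathrm{Id}+L(x)\otimes l_x+R(x)\otimes r_x+T(x)\otimes\mathrm{Ad}_x,$$ where $l_x[A]=\psi^\dagger(x)A$, $r_x[A]=A\psi(x)$, $\mathrm{Ad}_x[A]=\psi^\dagger(x)A\psi(x)$. The domain consists of the vectors $\Phi\in\mathfrak F$ for which there is $\Xi\in\mathfrak F$ such that, for every finite-particle $\Psi$, the Dyson series for $\langle\Psi|O|\Phi\rangle$ converges absolutely to $\langle\Psi|\Xi\rangle$; then $O\Phi=\Xi$. Let $(B_2,Q_2,L_2)$ be tensors of a cMPS of bond dimension $D_2$, and let $O_1=O[B_1,Q_1,L_1,R_1,T_1]$ be a cMPO of bond dimension $D_1$, with tensors in the above classes. Then: 1. $|\psi[B_2,Q_2,L_2]\rangle$ is a well-defined vector of $\mathfrak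 F$, the vacuum lies in the domain of the cMPO $O_2=O[B_2,Q_2,L_2,0,\mathbb 1_{D_2}]$, and $|\psi[B_2,Q_2,L_2]\rangle=O_2|\Omega\rangle$. 2. $|\psi[B_2,Q_2,L_2]\rangle$ lies in the domain of $O_1$, and $O_1|\psi[B_2,Q_2,L_2]\rangle=|\psi[B,Q,L]\rangle$ is the cMPS with tensors $$B=B_1\otimes B_2,\qquad L=L_1\otimes\mathbb 1_{D_2}+T_1\otimes L_2,\qquad Q=Q_1\otimes\mathbb 1_{D_2}+\mathbb 1_{D_1}\otimes Q_2+R_1\otimes L_2,$$ where again $Q\in L^1(I)$ and $L\in L^2(I)$. In particular $O_1$ maps a cMPS of bond dimension $D_2$ to a cMPS of bond dimension at most $D_1D_2$. -/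

import Mathlib

open MeasureTheory
open scoped Kronecker ComplexConjugate

noncomputable section

namespace CMPO

/-! ### Fock space over `L²(I)` -/

/-- Lebesgue measure on `Iⁿ`. -/
abbrev cubeMeasure (I : Set ℝ) (n : ℕ) : Measure (Fin n → ℝ) :=
  Measure.pi fun _ => volume.restrict I

/-- Lebesgue measure on the path-ordered configurations `x₁ < ⋯ < xₘ` of points of `I`. -/
abbrev orderedMeasure (I : Set ℝ) (m : ℕ) : Measure (Fin m → ℝ) :=
  (cubeMeasure I m).restrict {x | StrictMono x}

theorem quasiMeasurePreserving_comp (I : Set ℝ) {n m : ℕ} (f : Fin n → Fin m)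
    (hf : Function.Injective f) :
    Measure.QuasiMeasurePreserving (fun (x : Fin m → ℝ) i => x (f i))
      (cubeMeasure I m) (cubeMeasure I n) := by
  classical
  obtain ⟨p, e, he⟩ : ∃ (p : Fin m → Prop) (e : Fin n ≃ {j // p j}), ∀ i, (e i : Fin m) = f i :=
    ⟨(· ∈ Set.range f), Equiv.ofInjective f hf, fun _ => rfl⟩
  have h1 := measurePreserving_piEquivPiSubtypeProd
    (fun _ : Fin m => (volume.restrict I : Measure ℝ)) p
  have h2 := Measure.quasiMeasurePreserving_fst.comp h1.quasiMeasurePreserving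
  have h3 := (measurePreserving_arrowCongr'
    (fun _ : {j // p j} => (volume.restrict I : Measure ℝ))
    (fun _ : Fin n => (volume.restrict I : Measure ℝ))
    e.symm (MeasurableEquiv.refl ℝ) (fun _ => MeasurePreserving.id _)).quasiMeasurePreserving
  convert h3.comp h2 using 1
  funext x i
  exact congrArg x (he i).symm

/-- The `n`-particle sector `L²(I)^{⊙n}`: the square-integrable functions on `Iⁿ` that are
invariant under permutations of the particles. -/
def sector (I : Set ℝ) (n : ℕ) : Submodule ℂ (Lp ℂ 2 (cubeMeasure I n)) where
  carrier := {f | ∀ σ : Equiv.Perm (Fin n),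
    (fun x : Fin n → ℝ => f (fun i => x (σ i))) =ᵐ[cubeMeasure I n] f}
  zero_mem' := fun σ => by
    have h0 := Lp.coeFn_zero ℂ 2 (cubeMeasure I n)
    exact ((quasiMeasurePreserving_comp I σ σ.injective).ae_eq_comp h0).trans h0.symm
  add_mem' := fun {f g} hf hg σ => by
    have h0 := Lp.coeFn_add f g
    refine ((quasiMeasurePreserving_comp I σ σ.injective).ae_eq_comp h0).trans
      (Filter.EventuallyEq.trans ?_ h0.symm)
    exact (hf σ).add (hg σ)
  smul_mem' := fun c f hf σ => by
    have h0 := Lp.coeFn_smul c f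
    refine ((quasiMeasurePreserving_comp I σ σ.injective).ae_eq_comp h0).trans
      (Filter.EventuallyEq.trans ?_ h0.symm)
    exact (hf σ).const_smul c

/-- The bosonic Fock space `⨁ₙ L²(I)^{⊙n}` (Hilbert sum). -/
abbrev Fock (I : Set ℝ) : Type := lp (fun n : ℕ => sector I n) 2

theorem memLp_one_zero (I : Set ℝ) :
    MemLp (fun _ : Fin 0 → ℝ => (1 : ℂ)) 2 (cubeMeasure I 0) := by
  have : IsFiniteMeasure (cubeMeasure I 0) := by
    rw [cubeMeasure, Measure.pi_of_empty]; infer_instance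
  exact memLp_const 1

/-- The Fock vacuum `|Ω⟩ = (1, 0, 0, …)`. -/
def vacuum (I : Set ℝ) : Fock I :=
  lp.single 2 0 ⟨(memLp_one_zero I).toLp _, fun σ => by
    filter_upwards with x
    congr 1
    exact Subsingleton.elim _ _⟩

/-- Vectors with finitely many non-zero particle sectors. -/
def FiniteParticle {I : Set ℝ} (Ψ : Fock I) : Prop := ∃ N : ℕ, ∀ n, N < n → Ψ n = 0

/-! ### Field operators and ladder maps

The annihilation operator `ψ(x)` acts on wavefunctions pointwise.  The creation operator `ψ†(x)`
is the adjoint of `ψ(x)` in the sense of forms, so a vector is represented by the functional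
`Ψ ↦ ⟨Ψ|χ⟩` and an operator by its matrix elements `(Ψ, Φ) ↦ ⟨Ψ|A|Φ⟩`. -/

/-- Wavefunctions with an arbitrary number of particles. -/
abbrev Wave : Type := (n : ℕ) → (Fin n → ℝ) → ℂ

/-- The wavefunction of a Fock vector. -/
def wave {I : Set ℝ} (Φ : Fock I) : Wave := fun n => ((Φ n : Lp ℂ 2 (cubeMeasure I n)) : _ → ℂ)

/-- `(ψ(x)φ)ₙ(y₁, …, yₙ) = √(n+1) φₙ₊₁(x, y₁, …, yₙ)`. -/
def annihilate (x : ℝ) (φ : Wave) : Wave :=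
  fun n y => (Real.sqrt (n + 1) : ℂ) * φ (n + 1) (Fin.cons x y)

/-- A generalized vector `χ`, given by `Ψ ↦ ⟨Ψ|χ⟩`. -/
abbrev VecForm : Type := Wave → ℂ

/-- A generalized operator `A`, given by `(Ψ, Φ) ↦ ⟨Ψ|A|Φ⟩`. -/
abbrev OpForm : Type := Wave → Wave → ℂ

/-- `|Ω⟩`. -/
def vacuumVec : VecForm := fun Ψ => conj (Ψ 0 ![])

/-- `ψ†(x)χ`, that is `⟨Ψ|ψ†(x)χ⟩ = ⟨ψ(x)Ψ|χ⟩`. -/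
def create (x : ℝ) (χ : VecForm) : VecForm := fun Ψ => χ (annihilate x Ψ)

/-- `|Ω⟩⟨Ω|`. -/
def vacuumProj : OpForm := fun Ψ Φ => conj (Ψ 0 ![]) * Φ 0 ![]

/-- `l_x[A] = ψ†(x) A`. -/
def leftMap (x : ℝ) (A : OpForm) : OpForm := fun Ψ Φ => A (annihilate x Ψ) Φ

/-- `r_x[A] = A ψ(x)`. -/
def rightMap (x : ℝ) (A : OpForm) : OpForm := fun Ψ Φ => A Ψ (annihilate x Φ)

/-- `Ad_x[A] = ψ†(x) A ψ(x)`. -/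
def adMap (x : ℝ) (A : OpForm) : OpForm := fun Ψ Φ => A (annihilate x Ψ) (annihilate x Φ)

/-! ### Path-ordered exponentials -/

section Bond

variable {ι : Type} [Fintype ι] [DecidableEq ι]

/-- `A ⊗ s` for a matrix `A` on the bond space and a map `s` on a space `V` of generalized vectors
or operators. -/
def bondTensor {V : Type} [AddCommMonoid V] [Module ℂ V] (A : Matrix ι ι ℂ) (s : V → V)
    (M : Matrix ι ι V) : Matrix ι ι V :=
  Matrix.of fun i j => ∑ k, A i k • s (M k j)

/-- `Tr_D(B M)`, the trace over the bond space. -/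
def bondTrace {V : Type} [AddCommMonoid V] [Module ℂ V] (B : Matrix ι ι ℂ) (M : Matrix ι ι V) : V :=
  ∑ i, ∑ k, B i k • M k i

/-- `G(x₁) G(x₂) ⋯ G(xₘ) w`. -/
def pathProduct {W : Type} (G : ℝ → W → W) (w : W) {m : ℕ} (x : Fin m → ℝ) : W :=
  (List.ofFn x).foldr G w

/-- `∑ₘ ∫_{x₁ < ⋯ < xₘ} F m x dx = s`, where all integrals and the series converge absolutely. -/
def HasDysonSum (I : Set ℝ) (F : (m : ℕ) → (Fin m → ℝ) → ℂ) (s : ℂ) : Prop :=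
  (∀ m, Integrable (F m) (orderedMeasure I m)) ∧
    HasSum (fun m => ∫ x, F m x ∂(orderedMeasure I m)) s

/-- `Q(x) ⊗ 1 + L(x) ⊗ ψ†(x)`. -/
def stateGenerator (Q L : ℝ → Matrix ι ι ℂ) (x : ℝ) (M : Matrix ι ι VecForm) :
    Matrix ι ι VecForm :=
  bondTensor (Q x) id M + bondTensor (L x) (create x) M

/-- The `m`-th integrand of the Dyson series of `Tr_D(B 𝒫exp ∫ (Q ⊗ 1 + L ⊗ ψ†)) |Ω⟩`. -/
def stateIntegrand (B : Matrix ι ι ℂ) (Q L : ℝ → Matrix ι ι ℂ) (m : ℕ) (x : Fin m → ℝ) : VecForm :=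
  bondTrace B (pathProduct (stateGenerator Q L) (Matrix.diagonal fun _ => vacuumVec) x)

/-- `Φ` is the continuous matrix product state
`|ψ[B,Q,L]⟩ = Tr_D(B 𝒫exp ∫_I (Q(x) ⊗ 1 + L(x) ⊗ ψ†(x)) dx) |Ω⟩`. -/
def IsCMPS (I : Set ℝ) (B : Matrix ι ι ℂ) (Q L : ℝ → Matrix ι ι ℂ) (Φ : Fock I) : Prop :=
  ∀ Ψ : Fock I, FiniteParticle Ψ →
    HasDysonSum I (fun m x => stateIntegrand B Q L m x (wave Ψ)) (inner ℂ Ψ Φ)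

/-- `𝔏_x = Q(x) ⊗ Id + L(x) ⊗ l_x + R(x) ⊗ r_x + T(x) ⊗ Ad_x`. -/
def operatorGenerator (Q L R T : ℝ → Matrix ι ι ℂ) (x : ℝ) (M : Matrix ι ι OpForm) :
    Matrix ι ι OpForm :=
  bondTensor (Q x) id M + bondTensor (L x) (leftMap x) M + bondTensor (R x) (rightMap x) M +
    bondTensor (T x) (adMap x) M

/-- The `m`-th integrand of the Dyson series of `Tr_D(B 𝒫exp ∫ 𝔏_x)(|Ω⟩⟨Ω|)`. -/
def operatorIntegrand (B : Matrix ι ι ℂ) (Q L R T : ℝ → Matrix ι ι ℂ) (m : ℕ) (x : Fin m → ℝ) :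
    OpForm :=
  bondTrace B (pathProduct (operatorGenerator Q L R T) (Matrix.diagonal fun _ => vacuumProj) x)

/-- `Ξ = Tr_D(B 𝒫exp ∫_I 𝔏_x dx)(|Ω⟩⟨Ω|) Φ`, tested against finite-particle vectors. -/
def OperatorAction (I : Set ℝ) (B : Matrix ι ι ℂ) (Q L R T : ℝ → Matrix ι ι ℂ) (Φ Ξ : Fock I) :
    Prop :=
  ∀ Ψ : Fock I, FiniteParticle Ψ →
    HasDysonSum I (fun m x => operatorIntegrand B Q L R T m x (wave Ψ) (wave Φ)) (inner ℂ Ψ Ξ)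

/-! The action is linear and single-valued, so it defines a partially defined linear operator. -/

theorem ext_finiteParticle {I : Set ℝ} {Ξ Ξ' : Fock I}
    (h : ∀ Ψ : Fock I, FiniteParticle Ψ → (inner ℂ Ψ Ξ : ℂ) = inner ℂ Ψ Ξ') : Ξ = Ξ' := by
  ext1
  funext n
  refine ext_inner_left ℂ fun v => ?_
  have := h (lp.single 2 n v) ⟨n, fun k hk => lp.single_apply_ne _ _ _ (by omega)⟩
  rwa [lp.inner_single_left, lp.inner_single_left] at this

theorem OperatorAction.unique {I : Set ℝ} {B : Matrix ι ι ℂ} {Q L R T : ℝ → Matrix ι ι ℂ}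
    {Φ Ξ Ξ' : Fock I} (h : OperatorAction I B Q L R T Φ Ξ) (h' : OperatorAction I B Q L R T Φ Ξ') :
    Ξ = Ξ' :=
  ext_finiteParticle fun Ψ hΨ => (h Ψ hΨ).2.unique (h' Ψ hΨ).2

theorem pathProduct_linear (Q L R T : ℝ → Matrix ι ι ℂ) (a b : ℂ) :
    ∀ (m : ℕ) (x : Fin m → ℝ) (ψ φ φ₁ φ₂ : Wave),
      (∀ (n : ℕ) (f : Fin n → Fin m), Function.Injective f →
        φ n (fun i => x (f i)) = a * φ₁ n (fun i => x (f i)) + b * φ₂ n (fun i => x (f i))) →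
      ∀ i j,
        pathProduct (operatorGenerator Q L R T) (Matrix.diagonal fun _ => vacuumProj) x i j ψ φ =
          a * pathProduct (operatorGenerator Q L R T) (Matrix.diagonal fun _ => vacuumProj)
              x i j ψ φ₁ +
          b * pathProduct (operatorGenerator Q L R T) (Matrix.diagonal fun _ => vacuumProj)
              x i j ψ φ₂ := by
  intro m
  induction m with
  | zero =>
    intro x ψ φ φ₁ φ₂ h i j
    have h0 := h 0 ![] (fun i => i.elim0)
    have e : (fun i => x ((![] : Fin 0 → Fin 0) i)) = ![] := Subsingleton.elim _ _
    rw [e] at h0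
    by_cases hij : i = j
    · subst hij
      simp only [pathProduct, List.ofFn_zero, List.foldr_nil, Matrix.diagonal_apply_eq, vacuumProj,
        h0]
      ring
    · simp [pathProduct, Matrix.diagonal_apply_ne _ hij]
  | succ m ih =>
    intro x ψ φ φ₁ φ₂ h i j
    have hstep : ∀ (χ θ : Wave),
        pathProduct (operatorGenerator Q L R T) (Matrix.diagonal fun _ => vacuumProj) x i j χ θ =
        ∑ k, (Q (x 0) i k * pathProduct (operatorGenerator Q L R T)
              (Matrix.diagonal fun _ => vacuumProj) (fun l : Fin m => x l.succ) k j χ θ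
          + L (x 0) i k * pathProduct (operatorGenerator Q L R T)
              (Matrix.diagonal fun _ => vacuumProj) (fun l : Fin m => x l.succ) k j
              (annihilate (x 0) χ) θ
          + R (x 0) i k * pathProduct (operatorGenerator Q L R T)
              (Matrix.diagonal fun _ => vacuumProj) (fun l : Fin m => x l.succ) k j
              χ (annihilate (x 0) θ)
          + T (x 0) i k * pathProduct (operatorGenerator Q L R T)
              (Matrix.diagonal fun _ => vacuumProj) (fun l : Fin m => x l.succ) k j
              (annihilate (x 0) χ) (annihilate (x 0) θ)) := by
      intro χ θ
      simp only [pathProduct, List.ofFn_succ, List.foldr_cons]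
      rw [operatorGenerator]
      simp [bondTensor, leftMap, rightMap, adMap, Finset.sum_add_distrib, Finset.sum_apply]
    have h1 : ∀ χ k, _ := fun χ k => ih (fun l => x l.succ) χ φ φ₁ φ₂
      (fun n f hf => h n (fun i => (f i).succ) fun _ _ e => hf (Fin.succ_injective _ e)) k j
    have h2 : ∀ χ k, _ := fun χ k => ih (fun l => x l.succ) χ (annihilate (x 0) φ)
      (annihilate (x 0) φ₁) (annihilate (x 0) φ₂)
      (fun n f hf => by
        have e : (Fin.cons (x 0) fun i => x (f i).succ : Fin (n + 1) → ℝ) =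
            fun i => x ((Fin.cons 0 fun i => (f i).succ : Fin (n + 1) → Fin (m + 1)) i) := by
          funext i
          refine Fin.cases ?_ (fun i => ?_) i <;> simp
        have hinj : Function.Injective
            (Fin.cons 0 fun i => (f i).succ : Fin (n + 1) → Fin (m + 1)) := by
          rw [Fin.cons_injective_iff]
          refine ⟨?_, fun _ _ e => hf (Fin.succ_injective _ e)⟩
          rintro ⟨i, hi⟩
          exact Fin.succ_ne_zero _ hi
        have := h (n + 1) _ hinj
        simp only [annihilate]
        rw [e, this]
        ring) k j
    rw [hstep ψ φ, hstep ψ φ₁, hstep ψ φ₂, Finset.mul_sum, Finset.mul_sum,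
      ← Finset.sum_add_distrib]
    refine Finset.sum_congr rfl fun k _ => ?_
    rw [h1, h1, h2, h2]
    ring

theorem operatorIntegrand_linear (I : Set ℝ) (B : Matrix ι ι ℂ) (Q L R T : ℝ → Matrix ι ι ℂ)
    (a b : ℂ) (Φ₁ Φ₂ : Fock I) (ψ : Wave) (m : ℕ) :
    (fun x => operatorIntegrand B Q L R T m x ψ (wave (a • Φ₁ + b • Φ₂)))
      =ᵐ[orderedMeasure I m]
    (fun x => a * operatorIntegrand B Q L R T m x ψ (wave Φ₁) +
      b * operatorIntegrand B Q L R T m x ψ (wave Φ₂)) := by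
  have hw : ∀ n, wave (a • Φ₁ + b • Φ₂) n =ᵐ[cubeMeasure I n]
      fun y => a * wave Φ₁ n y + b * wave Φ₂ n y := by
    intro n
    have e : (((a • Φ₁ + b • Φ₂ : Fock I) n : sector I n) : Lp ℂ 2 (cubeMeasure I n)) =
        a • (Φ₁ n : Lp ℂ 2 (cubeMeasure I n)) + b • (Φ₂ n : Lp ℂ 2 (cubeMeasure I n)) := rfl
    unfold wave
    rw [e]
    filter_upwards [Lp.coeFn_add (a • (Φ₁ n : Lp ℂ 2 (cubeMeasure I n)))
      (b • (Φ₂ n : Lp ℂ 2 (cubeMeasure I n))), Lp.coeFn_smul a (Φ₁ n : Lp ℂ 2 (cubeMeasure I n)),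
      Lp.coeFn_smul b (Φ₂ n : Lp ℂ 2 (cubeMeasure I n))] with y h1 h2 h3
    rw [h1, Pi.add_apply, h2, h3]
    rfl
  have hall : ∀ᵐ x ∂(cubeMeasure I m), ∀ (n : ℕ) (f : Fin n → Fin m), Function.Injective f →
      wave (a • Φ₁ + b • Φ₂) n (fun i => x (f i)) =
        a * wave Φ₁ n (fun i => x (f i)) + b * wave Φ₂ n (fun i => x (f i)) := by
    rw [ae_all_iff]; intro n
    rw [ae_all_iff]; intro f
    by_cases hf : Function.Injective f
    · filter_upwards [(quasiMeasurePreserving_comp I f hf).ae (hw n)] with x hx _ using hx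
    · exact Filter.Eventually.of_forall fun x h => absurd h hf
  filter_upwards [ae_restrict_of_ae hall] with x hx
  have key := pathProduct_linear Q L R T a b m x ψ _ _ _ hx
  simp only [operatorIntegrand, bondTrace, Finset.sum_apply, Pi.smul_apply, smul_eq_mul, key,
    Finset.mul_sum, ← Finset.sum_add_distrib]
  refine Finset.sum_congr rfl fun i _ => Finset.sum_congr rfl fun k _ => ?_
  ring

theorem OperatorAction.linear {I : Set ℝ} {B : Matrix ι ι ℂ} {Q L R T : ℝ → Matrix ι ι ℂ}
    {Φ₁ Φ₂ Ξ₁ Ξ₂ : Fock I} (h₁ : OperatorAction I B Q L R T Φ₁ Ξ₁)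
    (h₂ : OperatorAction I B Q L R T Φ₂ Ξ₂) (a b : ℂ) :
    OperatorAction I B Q L R T (a • Φ₁ + b • Φ₂) (a • Ξ₁ + b • Ξ₂) := by
  intro Ψ hΨ
  obtain ⟨i₁, s₁⟩ := h₁ Ψ hΨ
  obtain ⟨i₂, s₂⟩ := h₂ Ψ hΨ
  have hl := operatorIntegrand_linear I B Q L R T a b Φ₁ Φ₂ (wave Ψ)
  refine ⟨fun m => (((i₁ m).const_mul a).add ((i₂ m).const_mul b)).congr (hl m).symm, ?_⟩
  rw [inner_add_right, inner_smul_right, inner_smul_right]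
  have hs : ∀ m, ∫ x, operatorIntegrand B Q L R T m x (wave Ψ) (wave (a • Φ₁ + b • Φ₂))
      ∂(orderedMeasure I m) =
      a * ∫ x, operatorIntegrand B Q L R T m x (wave Ψ) (wave Φ₁) ∂(orderedMeasure I m) +
      b * ∫ x, operatorIntegrand B Q L R T m x (wave Ψ) (wave Φ₂) ∂(orderedMeasure I m) :=
    fun m => by
      rw [integral_congr_ae (hl m), integral_add ((i₁ m).const_mul a) ((i₂ m).const_mul b),
        integral_const_mul, integral_const_mul]
  simp only [hs]
  exact (s₁.mul_left a).add (s₂.mul_left b)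

theorem OperatorAction.zero (I : Set ℝ) (B : Matrix ι ι ℂ) (Q L R T : ℝ → Matrix ι ι ℂ) :
    OperatorAction I B Q L R T 0 0 := by
  intro Ψ hΨ
  have hl : ∀ m, (fun x => operatorIntegrand B Q L R T m x (wave Ψ) (wave (0 : Fock I)))
      =ᵐ[orderedMeasure I m] fun _ => 0 := fun m => by
    have := operatorIntegrand_linear I B Q L R T 0 0 0 0 (wave Ψ) m
    simpa using this
  refine ⟨fun m => (integrable_zero _ _ _).congr (hl m).symm, ?_⟩
  rw [inner_zero_right]
  have hz : ∀ m, ∫ x, operatorIntegrand B Q L R T m x (wave Ψ) (wave (0 : Fock I))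
      ∂(orderedMeasure I m) = 0 := fun m => by rw [integral_congr_ae (hl m), integral_zero]
  simp only [hz]
  exact hasSum_zero

/-- The continuous matrix product operator
`O[B,Q,L,R,T] = Tr_D(B 𝒫exp ∫_I 𝔏_x dx)(|Ω⟩⟨Ω|)` on its natural domain in Fock space. -/
def cMPO (I : Set ℝ) (B : Matrix ι ι ℂ) (Q L R T : ℝ → Matrix ι ι ℂ) : Fock I →ₗ.[ℂ] Fock I where
  domain :=
    { carrier := {Φ | ∃ Ξ, OperatorAction I B Q L R T Φ Ξ}
      zero_mem' := ⟨0, OperatorAction.zero I B Q L R T⟩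
      add_mem' := fun {Φ₁ Φ₂} ⟨Ξ₁, h₁⟩ ⟨Ξ₂, h₂⟩ => ⟨Ξ₁ + Ξ₂, by simpa using h₁.linear h₂ 1 1⟩
      smul_mem' := fun c Φ ⟨Ξ, h⟩ => ⟨c • Ξ, by simpa using h.linear h c 0⟩ }
  toFun :=
    { toFun := fun Φ => Φ.2.choose
      map_add' := fun Φ₁ Φ₂ => OperatorAction.unique (Φ₁ + Φ₂).2.choose_spec
        (by simpa using Φ₁.2.choose_spec.linear Φ₂.2.choose_spec 1 1)
      map_smul' := fun c Φ => OperatorAction.unique (c • Φ).2.choose_spec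
        (by simpa using Φ.2.choose_spec.linear Φ.2.choose_spec c 0) }

theorem cMPO_apply_eq_iff {I : Set ℝ} {B : Matrix ι ι ℂ} {Q L R T : ℝ → Matrix ι ι ℂ}
    {Φ Ξ : Fock I} :
    (∃ h : Φ ∈ (cMPO I B Q L R T).domain, cMPO I B Q L R T ⟨Φ, h⟩ = Ξ) ↔
      OperatorAction I B Q L R T Φ Ξ := by
  constructor
  · rintro ⟨h, rfl⟩
    exact h.choose_spec
  · intro h
    have hd : Φ ∈ (cMPO I B Q L R T).domain := ⟨Ξ, h⟩
    exact ⟨hd, OperatorAction.unique hd.choose_spec h⟩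

/-- Regularity of the tensors of a cMPS: `Q ∈ L¹(I)`, `L ∈ L²(I)`. -/
def StateTensors (I : Set ℝ) (Q L : ℝ → Matrix ι ι ℂ) : Prop :=
  (∀ i j, MemLp (fun x => Q x i j) 1 (volume.restrict I)) ∧
    ∀ i j, MemLp (fun x => L x i j) 2 (volume.restrict I)

/-- Regularity of the tensors of a cMPO: `Q ∈ L¹(I)`, `L, R ∈ L²(I)`, `T ∈ L^∞(I)`. -/
def OperatorTensors (I : Set ℝ) (Q L R T : ℝ → Matrix ι ι ℂ) : Prop :=
  StateTensors I Q L ∧ (∀ i j, MemLp (fun x => R x i j) 2 (volume.restrict I)) ∧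
    ∀ i j, MemLp (fun x => T x i j) ⊤ (volume.restrict I)

end Bond

end CMPO

end

/-! A Fock vector is a square-integrable function on finite point configurations: an `n`-particle
wavefunction is recorded as `√(n!) φₙ` on `n`-point sets (`config`), with Lebesgue measure divided
by `m!` on `m`-tuples (`configMeasure`). In this normalisation `ψ(a)` just adds the point `a` to the
argument, and the Fock inner product is the `L²` inner product (`inner_ofConfig`).

At each point of an ordered tuple the generator makes a choice. For a state the choice is `Q` or
`L`, so a Dyson integrand is a sum over the set `S` of points carrying `ψ†`. For an operator the
choice is among `Q, L, R, T`, recorded by the set `S` of points passed to the bra and the set `U`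
passed to the ket.

The analytic tool is the sum-integral formula: integrating `G(α, β)` over pairs of configurations
equals integrating `∑ G(S, ω \ S)` over one configuration `ω` (`configMeasure_prod`,
`lintegral_enorm_split`, `hasDysonSum_split`). With it, the value of a cMPS at `α` is the integral
over `β` of the path-ordered trace with `L` on `α` and `Q` on `β`.

When the operator acts on a state, the operator occupies points `σ`, consumes the state's particles
at `U ⊆ σ`, and the state has further `Q₂`-points `β`. Merging `ρ = σ ∪ β` and summing over all
choices, each point of `ρ` independently contributes `Q₁`, `Q₂` or `R₁L₂` if no particle is emitted,
and `L₁` or `T₁L₂` if one is. The two bond spaces commute, so this is the distributive law for the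
product tensors (`sum_orderedProd_mul`, `sum_trace_mul_trace`).

Absolute convergence comes from the same identity applied to the scalar majorants `entrySum`: since
`L₁ + T₁L₂` is in `L²` and `Q₁ + Q₂ + R₁L₂` in `L¹`, the recombined majorant is integrable by
Cauchy–Schwarz and the exponential series. Fubini then identifies the Dyson series of the operator
action with that of the image state. -/

noncomputable section

namespace CMPO

/-! ### Path-ordered products over finite sets of points -/

section OrderedProd

variable {A : Type*}

/-- The product of the values of `f` at the points of `σ`, in increasing order. -/
def orderedProd [Monoid A] (f : ℝ → A) (σ : Finset ℝ) : A := ((σ.sort (· ≤ ·)).map f).prod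

/-- `f` on `S` and `g` elsewhere. -/
def pick (S : Finset ℝ) (f g : ℝ → A) (t : ℝ) : A := if t ∈ S then f t else g t

/-- `T` on `S ∩ U`, `L` on `S \ U`, `R` on `U \ S` and `Q` elsewhere. -/
def pickFour (S U : Finset ℝ) (Q L R T : ℝ → A) (t : ℝ) : A :=
  if t ∈ S then if t ∈ U then T t else L t else if t ∈ U then R t else Q t

section Monoid

variable [Monoid A]

@[simp] theorem orderedProd_empty (f : ℝ → A) : orderedProd f ∅ = 1 := by simp [orderedProd]

theorem orderedProd_insert (f : ℝ → A) {a : ℝ} {σ : Finset ℝ} (h : ∀ b ∈ σ, a < b) :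
    orderedProd f (insert a σ) = f a * orderedProd f σ := by
  unfold orderedProd
  rw [Finset.sort_insert _ (fun b hb => (h b hb).le) fun ha => lt_irrefl _ (h a ha)]
  simp

theorem orderedProd_congr {f g : ℝ → A} {σ : Finset ℝ} (h : ∀ t ∈ σ, f t = g t) :
    orderedProd f σ = orderedProd g σ := by
  unfold orderedProd
  rw [List.map_congr_left fun t ht => h t ((Finset.mem_sort _).1 ht)]

theorem map_orderedProd {A' F : Type*} [Monoid A'] [FunLike F A A'] [MonoidHomClass F A A']
    (φ : F) (f : ℝ → A) (σ : Finset ℝ) :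
    φ (orderedProd f σ) = orderedProd (fun t => φ (f t)) σ := by
  simp [orderedProd, map_list_prod, Function.comp_def]

theorem commute_orderedProd {b : A} {f : ℝ → A} (h : ∀ t, Commute b (f t)) (σ : Finset ℝ) :
    Commute b (orderedProd f σ) := by
  refine Commute.list_prod_right _ _ fun c hc => ?_
  obtain ⟨t, -, rfl⟩ := List.mem_map.1 hc
  exact h t

theorem orderedProd_pick_insert_left (f g : ℝ → A) {a : ℝ} {σ S : Finset ℝ}
    (h : ∀ b ∈ σ, a < b) : orderedProd (pick (insert a S) f g) σ = orderedProd (pick S f g) σ :=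
  orderedProd_congr fun t ht => by simp [pick, (h t ht).ne']

end Monoid

theorem orderedProd_eq_prod [CommMonoid A] (f : ℝ → A) (σ : Finset ℝ) :
    orderedProd f σ = ∏ t ∈ σ, f t := by
  unfold orderedProd
  rw [((Finset.sort_perm_toList σ _).map f).prod_eq]
  exact (Finset.prod_eq_multiset_prod σ f).symm ▸ by
    rw [← Multiset.prod_coe, ← Multiset.map_coe, Finset.coe_toList]

theorem orderedProd_nonneg {f : ℝ → ℝ} (hf : ∀ t, 0 ≤ f t) (σ : Finset ℝ) :
    0 ≤ orderedProd f σ := by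
  rw [orderedProd_eq_prod]
  exact Finset.prod_nonneg fun t _ => hf t

/-- For two commuting families, the path-ordered product of
`Q₁ + Q₂ + R₁L₂` (off `S`) and `L₁ + T₁L₂` (on `S`) expands into pairs of path-ordered products,
the second of which uses the points outside `σ` and those of `U ⊆ σ`. -/
theorem sum_orderedProd_mul {k : Type*} [CommSemiring k] [Semiring A] [Algebra k A]
    (Q₁ L₁ R₁ T₁ Q₂ L₂ : ℝ → A)
    (hQ : ∀ s S U t, Commute (Q₂ s) (pickFour S U Q₁ L₁ R₁ T₁ t))
    (hL : ∀ s S U t, Commute (L₂ s) (pickFour S U Q₁ L₁ R₁ T₁ t)) (ρ : Finset ℝ) :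
    ∀ c : Finset ℝ → k,
      ∑ σ ∈ ρ.powerset, ∑ S ∈ σ.powerset, ∑ U ∈ σ.powerset,
        c S • (orderedProd (pickFour S U Q₁ L₁ R₁ T₁) σ *
          orderedProd (pick U L₂ Q₂) (U ∪ (ρ \ σ))) =
      ∑ S ∈ ρ.powerset, c S • orderedProd
        (pick S (fun t => L₁ t + T₁ t * L₂ t) (fun t => Q₁ t + Q₂ t + R₁ t * L₂ t)) ρ := by
  -- The new point `a` is the smallest, hence the leftmost factor. The weight `c` stays general
  -- because the case `a ∈ S` uses the hypothesis for `S ↦ c (insert a S)`.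
  induction ρ using Finset.induction_on_min with
  | empty => intro c; simp
  | insert a ρ ha ih =>
    intro c
    have haρ : a ∉ ρ := fun h => lt_irrefl _ (ha a h)
    set f₁ : Finset ℝ → Finset ℝ → Finset ℝ → A :=
      fun S U σ => orderedProd (pickFour S U Q₁ L₁ R₁ T₁) σ with hf₁
    set f₂ : Finset ℝ → Finset ℝ → A :=
      fun U σ => orderedProd (pick U L₂ Q₂) (U ∪ (ρ \ σ)) with hf₂
    have hlt : ∀ {σ : Finset ℝ}, σ ∈ ρ.powerset → ∀ b ∈ σ, a < b :=
      fun hσ b hb => ha b (Finset.mem_powerset.1 hσ hb)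
    have hins : ∀ {σ : Finset ℝ}, σ ∈ ρ.powerset → a ∉ σ :=
      fun hσ h => haρ (Finset.mem_powerset.1 hσ h)
    have hsub : ∀ {σ S : Finset ℝ}, σ ∈ ρ.powerset → S ∈ σ.powerset → S ∈ ρ.powerset :=
      fun hσ hS => Finset.mem_powerset.2
        ((Finset.mem_powerset.1 hS).trans (Finset.mem_powerset.1 hσ))
    have hfour : ∀ {σ : Finset ℝ} (S U : Finset ℝ), σ ∈ ρ.powerset →
        f₁ (insert a S) U σ = f₁ S U σ ∧ f₁ S (insert a U) σ = f₁ S U σ := by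
      refine fun S U hσ => ⟨orderedProd_congr fun t ht => ?_, orderedProd_congr fun t ht => ?_⟩ <;>
      · simp [pickFour, (hlt hσ t ht).ne']
    have h₂ : ∀ {U σ : Finset ℝ}, U ∈ ρ.powerset →
        ∀ b ∈ U ∪ (ρ \ σ), a < b := fun hU b hb => by
      rcases Finset.mem_union.1 hb with hb | hb
      · exact hlt hU b hb
      · exact ha b (Finset.mem_sdiff.1 hb).1
    rw [Finset.sum_powerset_insert haρ, Finset.sum_powerset_insert haρ]
    -- Case `a ∉ σ`: only the state acts at `a`, through `Q₂`, which is moved left past the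
    -- operator's product.
    have e₁ : ∑ σ ∈ ρ.powerset, ∑ S ∈ σ.powerset, ∑ U ∈ σ.powerset,
        c S • (f₁ S U σ * orderedProd (pick U L₂ Q₂) (U ∪ (insert a ρ \ σ))) =
        Q₂ a * ∑ σ ∈ ρ.powerset, ∑ S ∈ σ.powerset, ∑ U ∈ σ.powerset,
          c S • (f₁ S U σ * f₂ U σ) := by
      simp only [Finset.mul_sum]
      refine Finset.sum_congr rfl fun σ hσ => Finset.sum_congr rfl fun S hS =>
        Finset.sum_congr rfl fun U hU => ?_
      rw [Finset.insert_sdiff_of_notMem _ (hins hσ), Finset.union_insert,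
        orderedProd_insert _ (h₂ (hsub hσ hU)), mul_smul_comm, ← mul_assoc, ← mul_assoc,
        (commute_orderedProd (hQ a S U) σ).eq]
      simp [pick, hins (hsub hσ hU), hf₁, hf₂]
    -- Case `a ∈ σ`: membership of `a` in `S` and `U` selects `Q₁`, `R₁`, `L₁` or `T₁`, and the
    -- state supplies a factor `L₂ a` exactly when `a ∈ U`.
    have e₂ : ∑ σ ∈ ρ.powerset, ∑ S ∈ (insert a σ).powerset, ∑ U ∈ (insert a σ).powerset,
        c S • (orderedProd (pickFour S U Q₁ L₁ R₁ T₁) (insert a σ) *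
          orderedProd (pick U L₂ Q₂) (U ∪ (insert a ρ \ insert a σ))) =
        (Q₁ a + R₁ a * L₂ a) * (∑ σ ∈ ρ.powerset, ∑ S ∈ σ.powerset, ∑ U ∈ σ.powerset,
          c S • (f₁ S U σ * f₂ U σ)) +
        (L₁ a + T₁ a * L₂ a) * (∑ σ ∈ ρ.powerset, ∑ S ∈ σ.powerset, ∑ U ∈ σ.powerset,
          c (insert a S) • (f₁ S U σ * f₂ U σ)) := by
      simp only [Finset.mul_sum, ← Finset.sum_add_distrib]
      refine Finset.sum_congr rfl fun σ hσ => ?_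
      rw [Finset.sum_powerset_insert (hins hσ), ← Finset.sum_add_distrib]
      refine Finset.sum_congr rfl fun S hS => ?_
      have hd : insert a ρ \ insert a σ = ρ \ σ := by
        rw [Finset.insert_sdiff_insert, Finset.sdiff_insert_of_notMem haρ]
      rw [Finset.sum_powerset_insert (hins hσ), Finset.sum_powerset_insert (hins hσ),
        ← Finset.sum_add_distrib, ← Finset.sum_add_distrib, ← Finset.sum_add_distrib]
      refine Finset.sum_congr rfl fun U hU => ?_
      have haS := hins (hsub hσ hS)
      have haU := hins (hsub hσ hU)
      simp only [hd, Finset.insert_union, orderedProd_insert _ (hlt hσ),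
        orderedProd_insert _ (h₂ (hsub hσ hU))]
      have p : orderedProd (pick (insert a U) L₂ Q₂) (U ∪ (ρ \ σ)) = f₂ U σ :=
        orderedProd_pick_insert_left _ _ (h₂ (hsub hσ hU))
      have q₁ := fun S U => (hfour (σ := σ) S U hσ).1
      have q₂ := fun S U => (hfour (σ := σ) S U hσ).2
      simp only [hf₁] at q₁ q₂
      have r : ∀ x : A, x * f₁ S U σ * (L₂ a * f₂ U σ) = x * L₂ a * (f₁ S U σ * f₂ U σ) := by
        intro x
        rw [mul_assoc, ← mul_assoc (f₁ S U σ), ← (commute_orderedProd (hL a S U) σ).eq]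
        simp only [mul_assoc, hf₁]
      have v₁ : pickFour S U Q₁ L₁ R₁ T₁ a = Q₁ a := by simp [pickFour, haS, haU]
      have v₂ : pickFour S (insert a U) Q₁ L₁ R₁ T₁ a = R₁ a := by simp [pickFour, haS]
      have v₃ : pickFour (insert a S) U Q₁ L₁ R₁ T₁ a = L₁ a := by simp [pickFour, haU]
      have v₄ : pickFour (insert a S) (insert a U) Q₁ L₁ R₁ T₁ a = T₁ a := by simp [pickFour]
      have v₅ : pick (insert a U) L₂ Q₂ a = L₂ a := by simp [pick]
      simp only [p, q₁, q₂, v₁, v₂, v₃, v₄, v₅]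
      rw [r, r]
      simp only [add_mul, mul_smul_comm, mul_assoc, smul_add, hf₁, hf₂]
    rw [e₁, e₂, ih c, ih fun S => c (insert a S), ← add_assoc, ← add_mul]
    simp only [Finset.mul_sum]
    congr 1
    · refine Finset.sum_congr rfl fun S hS => ?_
      rw [orderedProd_insert _ ha, mul_smul_comm]
      simp only [pick, hins hS, if_false]
      congr 2
      abel
    · refine Finset.sum_congr rfl fun S hS => ?_
      rw [orderedProd_insert _ ha, mul_smul_comm, orderedProd_pick_insert_left _ _ ha]
      simp [pick]

end OrderedProd

/-! ### The values of a wavefunction on configurations -/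

/-- `√(n!) φₙ(t₁, …, tₙ)` for the configuration `t₁ < ⋯ < tₙ`. -/
def config (φ : Wave) (σ : Finset ℝ) : ℂ :=
  (Real.sqrt (σ.card.factorial) : ℂ) * φ σ.card (σ.orderEmbOfFin rfl)

theorem config_eq (φ : Wave) {σ : Finset ℝ} {n : ℕ} {x : Fin n → ℝ} (hx : StrictMono x)
    (h : Finset.univ.image x = σ) : config φ σ = (Real.sqrt (n.factorial) : ℂ) * φ n x := by
  have hc : σ.card = n := by
    rw [← h, Finset.card_image_of_injective _ hx.injective, Finset.card_fin]
  subst hc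
  unfold config
  rw [Finset.orderEmbOfFin_unique rfl (fun i => by rw [← h]; simp) hx]

theorem image_orderEmbOfFin (σ : Finset ℝ) {n : ℕ} (h : σ.card = n) :
    Finset.univ.image (σ.orderEmbOfFin h) = σ := by
  ext t
  rw [← Finset.mem_coe, ← Finset.mem_coe, ← Finset.range_orderEmbOfFin σ h]
  simp

@[simp] theorem config_empty (φ : Wave) : config φ ∅ = φ 0 ![] := by
  rw [config_eq φ (n := 0) (x := ![]) (fun i => i.elim0) (by simp)]
  simp

/-- The `√(n+1)` in the annihilation operator is absorbed by `√((n+1)!)`; this is the reason for the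
normalisation of `config`. -/
theorem config_insert (φ : Wave) {a : ℝ} {σ : Finset ℝ} (h : ∀ b ∈ σ, a < b) :
    config φ (insert a σ) = config (annihilate a φ) σ := by
  have hm : StrictMono (Fin.cons a (σ.orderEmbOfFin rfl) : Fin (σ.card + 1) → ℝ) := by
    intro i j
    refine Fin.cases ?_ (fun i => ?_) i <;> refine Fin.cases ?_ (fun j => ?_) j
    · intro h; exact absurd h (lt_irrefl _)
    · intro _
      simpa using h _ (Finset.orderEmbOfFin_mem σ rfl j)
    · intro h; exact absurd h (by simp)
    · intro h
      simpa using h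
  rw [config_eq φ hm]
  · unfold config annihilate
    rw [Nat.factorial_succ]
    push_cast
    rw [Real.sqrt_mul (by positivity)]
    push_cast
    ring
  · ext t
    have := Finset.ext_iff.1 (image_orderEmbOfFin σ rfl) t
    simp only [Finset.mem_image, Finset.mem_univ, true_and] at this
    simp [Fin.exists_fin_succ, ← this, eq_comm]

theorem sum_sum_mul_sum_eq_trace {κ ι : Type*} [Fintype ι] (s : Finset κ) (B : Matrix ι ι ℂ) (c : κ → ℂ)
    (X : κ → Matrix ι ι ℂ) :
    ∑ i, ∑ k, B i k * ∑ a ∈ s, c a * X a k i = ∑ a ∈ s, c a * (B * X a).trace := by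
  simp only [Matrix.trace, Matrix.diag, Matrix.mul_apply, Finset.mul_sum]
  rw [Finset.sum_comm]
  simp only [Finset.sum_comm (s := s)]
  rw [Finset.sum_comm]
  refine Finset.sum_congr rfl fun i _ => Finset.sum_congr rfl fun k _ =>
    Finset.sum_congr rfl fun a _ => ?_
  ring

/-! ### Expansion of the Dyson integrands over subsets of points -/

section Bond

variable {ι : Type} [Fintype ι] [DecidableEq ι]

/-- Distributivity: `S` collects the points where the term with `ψ†` is chosen. The test function is
quantified inside the induction because `ψ†(a)` replaces it by its annihilated version. -/
theorem foldr_stateGenerator (Q L : ℝ → Matrix ι ι ℂ) (σ : Finset ℝ) :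
    ∀ (ψ : Wave) (i j : ι),
      (σ.sort (· ≤ ·)).foldr (stateGenerator Q L) (Matrix.diagonal fun _ => vacuumVec) i j ψ =
        ∑ S ∈ σ.powerset, conj (config ψ S) * orderedProd (pick S L Q) σ i j := by
  induction σ using Finset.induction_on_min with
  | empty =>
    intro ψ i j
    by_cases hij : i = j
    · subst hij; simp [vacuumVec]
    · simp [hij]
  | insert a σ ha ih =>
    intro ψ i j
    have haσ : a ∉ σ := fun h => lt_irrefl _ (ha a h)
    rw [Finset.sort_insert _ (fun b hb => (ha b hb).le) haσ, List.foldr_cons,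
      Finset.sum_powerset_insert haσ, stateGenerator]
    simp only [Matrix.add_apply, bondTensor, Matrix.of_apply, id, create, Pi.add_apply,
      Finset.sum_apply, Pi.smul_apply, smul_eq_mul]
    simp only [ih, Finset.mul_sum]
    congr 1 <;> rw [Finset.sum_comm] <;> refine Finset.sum_congr rfl fun S hS => ?_ <;>
      have hS' := Finset.mem_powerset.1 hS <;>
      have haS : a ∉ S := fun h => haσ (hS' h)
    · rw [orderedProd_insert _ ha, Matrix.mul_apply, Finset.mul_sum]
      refine Finset.sum_congr rfl fun k _ => ?_
      simp only [pick, haS, if_false]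
      ring
    · rw [orderedProd_insert _ ha, Matrix.mul_apply, Finset.mul_sum,
        orderedProd_pick_insert_left _ _ ha, config_insert ψ fun b hb => ha b (hS' hb)]
      refine Finset.sum_congr rfl fun k _ => ?_
      simp only [pick, Finset.mem_insert_self, if_true]
      ring

/-- The same expansion with four choices per point: `S` collects the points annihilated in the bra
(`L` or `T`), `U` those annihilated in the ket (`R` or `T`). -/
theorem foldr_operatorGenerator (Q L R T : ℝ → Matrix ι ι ℂ) (σ : Finset ℝ) :
    ∀ (ψ φ : Wave) (i j : ι),
      (σ.sort (· ≤ ·)).foldr (operatorGenerator Q L R T) (Matrix.diagonal fun _ => vacuumProj)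
          i j ψ φ =
        ∑ S ∈ σ.powerset, ∑ U ∈ σ.powerset,
          conj (config ψ S) * config φ U * orderedProd (pickFour S U Q L R T) σ i j := by
  induction σ using Finset.induction_on_min with
  | empty =>
    intro ψ φ i j
    by_cases hij : i = j
    · subst hij; simp [vacuumProj]
    · simp [hij]
  | insert a σ ha ih =>
    intro ψ φ i j
    have haσ : a ∉ σ := fun h => lt_irrefl _ (ha a h)
    have hfour : ∀ (S U : Finset ℝ),
        orderedProd (pickFour (insert a S) U Q L R T) σ = orderedProd (pickFour S U Q L R T) σ ∧
        orderedProd (pickFour S (insert a U) Q L R T) σ =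
          orderedProd (pickFour S U Q L R T) σ := by
      refine fun S U => ⟨orderedProd_congr fun t ht => ?_, orderedProd_congr fun t ht => ?_⟩ <;>
      · simp [pickFour, (ha t ht).ne']
    have q₁ := fun S U => (hfour S U).1
    have q₂ := fun S U => (hfour S U).2
    rw [Finset.sort_insert _ (fun b hb => (ha b hb).le) haσ, List.foldr_cons,
      Finset.sum_powerset_insert haσ, operatorGenerator]
    simp only [Matrix.add_apply, bondTensor, Matrix.of_apply, id, leftMap, rightMap, adMap,
      Pi.add_apply, Finset.sum_apply, Pi.smul_apply, smul_eq_mul]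
    simp only [ih, ← Finset.sum_add_distrib, Finset.mul_sum]
    rw [Finset.sum_comm]
    refine Finset.sum_congr rfl fun S hS => ?_
    rw [Finset.sum_powerset_insert haσ]
    simp only [← Finset.sum_add_distrib]
    rw [Finset.sum_comm]
    refine Finset.sum_congr rfl fun U hU => ?_
    have hS' := Finset.mem_powerset.1 hS
    have hU' := Finset.mem_powerset.1 hU
    have haS : a ∉ S := fun h => haσ (hS' h)
    have haU : a ∉ U := fun h => haσ (hU' h)
    simp only [orderedProd_insert _ ha, Matrix.mul_apply, Finset.mul_sum, q₁, q₂,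
      config_insert ψ fun b hb => ha b (hS' hb), config_insert φ fun b hb => ha b (hU' hb),
      ← Finset.sum_add_distrib]
    refine Finset.sum_congr rfl fun k _ => ?_
    have v₁ : pickFour S U Q L R T a = Q a := by simp [pickFour, haS, haU]
    have v₂ : pickFour S (insert a U) Q L R T a = R a := by simp [pickFour, haS]
    have v₃ : pickFour (insert a S) U Q L R T a = L a := by simp [pickFour, haU]
    have v₄ : pickFour (insert a S) (insert a U) Q L R T a = T a := by simp [pickFour]
    rw [v₁, v₂, v₃, v₄]
    ring

theorem sort_image_univ {m : ℕ} {x : Fin m → ℝ} (hx : StrictMono x) :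
    (Finset.univ.image x).sort (· ≤ ·) = List.ofFn x := by
  refine List.Perm.eq_of_pairwise' (r := (· ≤ ·)) (Finset.pairwise_sort _ _) ?_ ?_
  · exact List.pairwise_ofFn.2 fun i j h => (hx h).le
  · refine (List.perm_ext_iff_of_nodup (Finset.sort_nodup _ _)
      (List.nodup_ofFn.2 hx.injective)).2 fun t => ?_
    simp [List.mem_ofFn]

theorem stateIntegrand_eq (B : Matrix ι ι ℂ) (Q L : ℝ → Matrix ι ι ℂ) {m : ℕ} {x : Fin m → ℝ}
    (hx : StrictMono x) (ψ : Wave) :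
    stateIntegrand B Q L m x ψ = ∑ S ∈ (Finset.univ.image x).powerset, conj (config ψ S) *
      (B * orderedProd (pick S L Q) (Finset.univ.image x)).trace := by
  simp only [stateIntegrand, bondTrace, pathProduct, ← sort_image_univ hx, Finset.sum_apply,
    Pi.smul_apply, foldr_stateGenerator, smul_eq_mul, ← sum_sum_mul_sum_eq_trace]

theorem operatorIntegrand_eq (B : Matrix ι ι ℂ) (Q L R T : ℝ → Matrix ι ι ℂ) {m : ℕ}
    {x : Fin m → ℝ} (hx : StrictMono x) (ψ φ : Wave) :
    operatorIntegrand B Q L R T m x ψ φ =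
      ∑ S ∈ (Finset.univ.image x).powerset, ∑ U ∈ (Finset.univ.image x).powerset,
        conj (config ψ S) * config φ U *
          (B * orderedProd (pickFour S U Q L R T) (Finset.univ.image x)).trace := by
  rw [← Finset.sum_product', ← sum_sum_mul_sum_eq_trace]
  simp only [operatorIntegrand, bondTrace, pathProduct, ← sort_image_univ hx, Finset.sum_apply,
    Pi.smul_apply, foldr_operatorGenerator, smul_eq_mul, Finset.sum_product]

end Bond

/-! ### Ordered and unordered configurations -/

/-- Reordering the coordinates of a tuple. -/
def permEquiv {m : ℕ} (π : Equiv.Perm (Fin m)) : (Fin m → ℝ) ≃ᵐ (Fin m → ℝ) :=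
  MeasurableEquiv.arrowCongr' π.symm (MeasurableEquiv.refl ℝ)

@[simp] theorem permEquiv_apply {m : ℕ} (π : Equiv.Perm (Fin m)) (x : Fin m → ℝ) :
    permEquiv π x = x ∘ π := rfl

@[simp] theorem permEquiv_symm_apply {m : ℕ} (π : Equiv.Perm (Fin m)) (x : Fin m → ℝ) :
    (permEquiv π).symm x = x ∘ π.symm := rfl

theorem measurePreserving_permEquiv (I : Set ℝ) {m : ℕ} (π : Equiv.Perm (Fin m)) :
    MeasurePreserving (permEquiv π) (cubeMeasure I m) (cubeMeasure I m) :=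
  measurePreserving_arrowCongr' _ _ _ _ fun _ => MeasurePreserving.id _

/-- Each coincidence `x i = x j` defines a proper linear subspace, which is Lebesgue-null. -/
theorem ae_injective (I : Set ℝ) (m : ℕ) :
    ∀ᵐ x ∂(cubeMeasure I m), Function.Injective x := by
  have h : ∀ i j : Fin m, i ≠ j → ∀ᵐ x ∂(cubeMeasure I m), x i ≠ x j := by
    intro i j hij
    rw [cubeMeasure, ← Measure.restrict_pi_pi]
    refine ae_restrict_of_ae ?_
    have h0 := Measure.addHaar_submodule (volume : Measure (Fin m → ℝ))
      (LinearMap.ker (LinearMap.proj (R := ℝ) (φ := fun _ : Fin m => ℝ) i - LinearMap.proj j)) (by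
        intro h
        have h1 := LinearMap.congr_fun (LinearMap.ker_eq_top.1 h) (Pi.single i 1)
        change (Pi.single i 1 : Fin m → ℝ) i - (Pi.single i 1 : Fin m → ℝ) j = 0 at h1
        simp [hij.symm] at h1)
    rw [ae_iff]
    refine (congrArg _ (Set.ext fun x => ?_)).trans h0
    change ¬ (x i ≠ x j) ↔ x i - x j = 0
    rw [not_not, sub_eq_zero]
  have h' : ∀ᵐ x ∂(cubeMeasure I m), ∀ i j : Fin m, i ≠ j → x i ≠ x j := by
    simp only [ae_all_iff]
    exact h
  filter_upwards [h'] with x hx i j hij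
  by_contra hne
  exact hx i j hne hij

theorem measurableSet_strictMono (m : ℕ) : MeasurableSet {x : Fin m → ℝ | StrictMono x} := by
  have : {x : Fin m → ℝ | StrictMono x} = ⋂ i, ⋂ j, ⋂ (_ : i < j), {x | x i < x j} := by
    ext x
    simp [StrictMono]
  rw [this]
  exact MeasurableSet.iInter fun i => MeasurableSet.iInter fun j => MeasurableSet.iInter fun _ =>
    measurableSet_lt (measurable_pi_apply i) (measurable_pi_apply j)

theorem ae_strictMono (I : Set ℝ) (m : ℕ) : ∀ᵐ x ∂(orderedMeasure I m), StrictMono x :=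
  ae_restrict_mem (measurableSet_strictMono m)

/-- Almost every configuration can be ordered in exactly one way. -/
theorem cubeMeasure_eq_sum (I : Set ℝ) (m : ℕ) :
    cubeMeasure I m =
      Measure.sum fun π : Equiv.Perm (Fin m) => (orderedMeasure I m).map (permEquiv π) := by
  have h : ∀ π : Equiv.Perm (Fin m), (orderedMeasure I m).map (permEquiv π) =
      (cubeMeasure I m).restrict {x | StrictMono (x ∘ π.symm)} := fun π => by
    rw [orderedMeasure]
    conv_rhs => rw [← (measurePreserving_permEquiv I π).map_eq]
    rw [(permEquiv π).restrict_map]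
    congr 2
    ext x
    simp [Function.comp_assoc]
  simp only [h]
  rw [← Measure.restrict_iUnion]
  · refine (Measure.restrict_eq_self_of_ae_mem ?_).symm
    filter_upwards [ae_injective I m] with x hx
    -- The copy indexed by `π` lives where `x ∘ π⁻¹` is increasing, so `π` is the inverse of the
    -- sorting permutation.
    refine Set.mem_iUnion.2 ⟨(Tuple.sort x).symm, ?_⟩
    exact (Tuple.monotone_sort x).strictMono_of_injective (hx.comp (Equiv.injective _))
  · intro π π' hne
    refine Set.disjoint_left.2 fun x hx hx' => hne ?_
    have e : x ∘ π.symm = x ∘ π'.symm := by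
      refine (StrictMono.range_inj hx hx').1 ?_
      rw [EquivLike.range_comp, EquivLike.range_comp]
    have hinj : Function.Injective x := by
      have := (StrictMono.injective hx).comp π.injective
      simpa [Function.comp_assoc] using this
    have := hinj.comp_left e
    exact Equiv.symm_bijective.injective (DFunLike.coe_injective this)
  · intro π
    exact (permEquiv π.symm).measurable (measurableSet_strictMono m)

section Symmetric

variable {I : Set ℝ} {m : ℕ}

/-- This and the next lemma reduce statements on the cube to increasing tuples, where `config` and
`orderedProd` are explicit. -/
theorem ae_cube_of_forall_perm {p : (Fin m → ℝ) → Prop}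
    (h : ∀ π : Equiv.Perm (Fin m), ∀ᵐ x ∂(orderedMeasure I m), p (x ∘ π)) :
    ∀ᵐ x ∂(cubeMeasure I m), p x := by
  rw [cubeMeasure_eq_sum, Measure.ae_sum_iff]
  intro π
  rw [(permEquiv π).measurableEmbedding.ae_map_iff]
  exact h π

theorem aestronglyMeasurable_cube {E : Type*} [NormedAddCommGroup E] {F : (Fin m → ℝ) → E}
    (h : ∀ π : Equiv.Perm (Fin m),
      AEStronglyMeasurable (fun x => F (x ∘ π)) (orderedMeasure I m)) :
    AEStronglyMeasurable F (cubeMeasure I m) := by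
  rw [cubeMeasure_eq_sum, aestronglyMeasurable_sum_measure_iff]
  intro π
  rw [(permEquiv π).measurableEmbedding.aestronglyMeasurable_map_iff]
  exact h π

theorem integral_cube_of_symm {F : (Fin m → ℝ) → ℂ}
    (hF : ∀ (π : Equiv.Perm (Fin m)) x, F (x ∘ π) = F x) (hi : Integrable F (cubeMeasure I m)) :
    ∫ x, F x ∂(cubeMeasure I m) = m.factorial * ∫ x, F x ∂(orderedMeasure I m) := by
  rw [cubeMeasure_eq_sum] at hi ⊢
  rw [integral_sum_measure hi]
  simp only [integral_map_equiv, permEquiv_apply, hF]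
  rw [tsum_fintype, Finset.sum_const, Finset.card_univ, Fintype.card_perm, Fintype.card_fin,
    nsmul_eq_mul]

end Symmetric

/-! ### The measure on configurations -/

/-- Configurations of finitely many points. -/
abbrev Configuration : Type := Σ m : ℕ, Fin m → ℝ

/-- The set of points of a configuration. -/
def Configuration.points (ω : Configuration) : Finset ℝ := Finset.univ.image ω.2

/-- An `m`-tuple of points as a configuration. -/
abbrev tuple (m : ℕ) : (Fin m → ℝ) → Configuration := Sigma.mk (β := fun m => Fin m → ℝ) m

theorem measurableEmbedding_tuple (m : ℕ) :
    MeasurableEmbedding (tuple m) where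
  injective := sigma_mk_injective
  measurable := fun s hs => MeasurableSpace.measurableSet_iInf.1 hs m
  measurableSet_image' := fun s hs => by
    refine MeasurableSpace.measurableSet_iInf.2 fun k => ?_
    change MeasurableSet (tuple k ⁻¹' (tuple m '' s))
    by_cases h : m = k
    · subst h
      rwa [Set.preimage_image_eq _ sigma_mk_injective]
    · convert MeasurableSet.empty
      ext x
      simp only [Set.mem_preimage, Set.mem_image, Set.mem_empty_iff_false, iff_false]
      rintro ⟨y, -, hy⟩
      exact h (congrArg Sigma.fst hy)

/-- The measure on configurations in `I`, which is Lebesgue measure divided by `m!` on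
`m`-tuples. -/
def configMeasure (I : Set ℝ) : Measure Configuration :=
  Measure.sum fun m => (m.factorial : ENNReal)⁻¹ • (cubeMeasure I m).map (tuple m)

instance (I : Set ℝ) : SFinite (configMeasure I) := by unfold configMeasure; infer_instance

theorem inv_factorial_ne_zero (m : ℕ) : (m.factorial : ENNReal)⁻¹ ≠ 0 :=
  ENNReal.inv_ne_zero.2 (ENNReal.natCast_ne_top _)

theorem inv_factorial_ne_top (m : ℕ) : (m.factorial : ENNReal)⁻¹ ≠ ⊤ :=
  ENNReal.inv_ne_top.2 (by exact_mod_cast m.factorial_ne_zero)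

theorem lintegral_configMeasure (I : Set ℝ) (f : Configuration → ENNReal) :
    ∫⁻ ω, f ω ∂(configMeasure I) =
      ∑' m : ℕ, (m.factorial : ENNReal)⁻¹ * ∫⁻ x, f ⟨m, x⟩ ∂(cubeMeasure I m) := by
  rw [configMeasure, lintegral_sum_measure]
  simp only [lintegral_smul_measure, (measurableEmbedding_tuple _).lintegral_map, smul_eq_mul]

theorem ae_configMeasure {I : Set ℝ} {p : Configuration → Prop} :
    (∀ᵐ ω ∂(configMeasure I), p ω) ↔ ∀ m, ∀ᵐ x ∂(cubeMeasure I m), p ⟨m, x⟩ := by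
  rw [configMeasure, Measure.ae_sum_iff]
  refine forall_congr' fun m => ?_
  rw [Measure.ae_ennreal_smul_measure_iff (inv_factorial_ne_zero m),
    (measurableEmbedding_tuple m).ae_map_iff]

theorem aestronglyMeasurable_configMeasure {I : Set ℝ} {E : Type*} [NormedAddCommGroup E]
    {f : Configuration → E}
    (h : ∀ m, AEStronglyMeasurable (fun x => f ⟨m, x⟩) (cubeMeasure I m)) :
    AEStronglyMeasurable f (configMeasure I) := by
  rw [configMeasure, aestronglyMeasurable_sum_measure_iff]
  exact fun m => AEStronglyMeasurable.smul_measure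
    ((measurableEmbedding_tuple m).aestronglyMeasurable_map_iff.2 (h m)) _

theorem integrable_fiber {I : Set ℝ} {f : Configuration → ℂ}
    (hf : Integrable f (configMeasure I)) (m : ℕ) :
    Integrable (fun x => f ⟨m, x⟩) (cubeMeasure I m) := by
  have h := (integrable_sum_measure_iff.1 hf).1 m
  rw [integrable_smul_measure (inv_factorial_ne_zero m) (inv_factorial_ne_top m)] at h
  exact (measurableEmbedding_tuple m).integrable_map_iff.1 h

theorem hasSum_integral_configMeasure {I : Set ℝ} {f : Configuration → ℂ}
    (hf : Integrable f (configMeasure I)) :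
    HasSum (fun m : ℕ => (m.factorial : ℂ)⁻¹ * ∫ x, f ⟨m, x⟩ ∂(cubeMeasure I m))
      (∫ ω, f ω ∂(configMeasure I)) := by
  have e : (fun m : ℕ => (m.factorial : ℂ)⁻¹ * ∫ x, f ⟨m, x⟩ ∂(cubeMeasure I m)) =
      fun m : ℕ => ∫ ω, f ω ∂((m.factorial : ENNReal)⁻¹ • (cubeMeasure I m).map (tuple m)) := by
    funext m
    rw [integral_smul_measure, (measurableEmbedding_tuple m).integral_map]
    simp
  rw [e]
  exact hasSum_integral_measure hf

theorem points_perm {m : ℕ} (x : Fin m → ℝ) (π : Equiv.Perm (Fin m)) :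
    Configuration.points ⟨m, x ∘ π⟩ = Configuration.points ⟨m, x⟩ := by
  simp only [Configuration.points]
  rw [← Finset.image_image, Finset.image_univ_equiv]

/-- An integrable function of configurations defines a convergent Dyson series. -/
theorem hasDysonSum_of_integrable {I : Set ℝ} {f : Finset ℝ → ℂ}
    (hf : Integrable (fun ω => f ω.points) (configMeasure I)) :
    HasDysonSum I (fun _ x => f (Finset.univ.image x)) (∫ ω, f ω.points ∂(configMeasure I)) := by
  have hi := integrable_fiber hf
  refine ⟨fun m => (hi m).mono_measure Measure.restrict_le_self, ?_⟩
  convert hasSum_integral_configMeasure hf using 2 with m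
  rw [integral_cube_of_symm (fun π x => by rw [points_perm]) (hi m), ← mul_assoc,
    inv_mul_cancel₀ (by exact_mod_cast m.factorial_ne_zero), one_mul]
  rfl

/-! ### Splitting configurations -/

/-- The parts of a configuration with indices in `S` and outside `S`. -/
def splitConfig {m : ℕ} (S : Finset (Fin m)) (x : Fin m → ℝ) : Configuration × Configuration :=
  (⟨S.card, x ∘ S.orderEmbOfFin rfl⟩, ⟨Sᶜ.card, x ∘ Sᶜ.orderEmbOfFin rfl⟩)

/-- Splitting the coordinates of a tuple. -/
def splitEquiv {m : ℕ} (S : Finset (Fin m)) :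
    (Fin m → ℝ) ≃ᵐ (Fin S.card → ℝ) × (Fin Sᶜ.card → ℝ) :=
  (MeasurableEquiv.arrowCongr' (finSumEquivOfFinset rfl rfl).symm (MeasurableEquiv.refl ℝ)).trans
    (MeasurableEquiv.sumPiEquivProdPi fun _ => ℝ)

theorem measurePreserving_splitEquiv (I : Set ℝ) {m : ℕ} (S : Finset (Fin m)) :
    MeasurePreserving (splitEquiv S) (cubeMeasure I m)
      ((cubeMeasure I S.card).prod (cubeMeasure I Sᶜ.card)) :=
  (measurePreserving_arrowCongr' _ _ _ _ fun _ => MeasurePreserving.id _).trans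
    (measurePreserving_sumPiEquivProdPi fun _ => volume.restrict I)

theorem splitConfig_eq {m : ℕ} (S : Finset (Fin m)) :
    splitConfig S = Prod.map (tuple S.card) (tuple Sᶜ.card) ∘ splitEquiv S := rfl

theorem measurableEmbedding_splitConfig {m : ℕ} (S : Finset (Fin m)) :
    MeasurableEmbedding (splitConfig S) := by
  rw [splitConfig_eq]
  exact ((measurableEmbedding_tuple _).prodMap (measurableEmbedding_tuple _)).comp
    (splitEquiv S).measurableEmbedding

theorem splitConfig_fst_points {m : ℕ} (S : Finset (Fin m)) (x : Fin m → ℝ) :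
    (splitConfig S x).1.points = S.image x := by
  change Finset.univ.image (x ∘ S.orderEmbOfFin rfl) = _
  rw [← Finset.image_image]
  congr 1
  exact Finset.coe_injective (by
    rw [Finset.coe_image, Finset.coe_univ, Set.image_univ, Finset.range_orderEmbOfFin])

theorem splitConfig_snd_points {m : ℕ} (S : Finset (Fin m)) (x : Fin m → ℝ) :
    (splitConfig S x).2.points = Sᶜ.image x := by
  change Finset.univ.image (x ∘ Sᶜ.orderEmbOfFin rfl) = _
  rw [← Finset.image_image]
  congr 1
  exact Finset.coe_injective (by
    rw [Finset.coe_image, Finset.coe_univ, Set.image_univ, Finset.range_orderEmbOfFin])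

/-- There are `m.choose n` subsets of size `n`, and `m.choose n / m! = 1 / (n! (m - n)!)`; pairs are
regrouped by their total size `m`. -/
theorem tsum_sum_finset_fin (a : ℕ → ℕ → ENNReal) :
    ∑' m : ℕ, ∑ S : Finset (Fin m), (m.factorial : ENNReal)⁻¹ * a S.card Sᶜ.card =
      ∑' p : ℕ × ℕ, (p.2.factorial : ENNReal)⁻¹ * ((p.1.factorial : ENNReal)⁻¹ * a p.1 p.2) := by
  rw [← Finset.HasAntidiagonal.sigmaAntidiagonalEquivProd.tsum_eq, ENNReal.tsum_sigma']
  refine tsum_congr fun m => ?_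
  have hc : ∀ S : Finset (Fin m), Sᶜ.card = m - S.card := fun S => by
    rw [Finset.card_compl, Fintype.card_fin]
  have h := Finset.sum_powerset_apply_card
    (fun n => (m.factorial : ENNReal)⁻¹ * a n (m - n)) (x := (Finset.univ : Finset (Fin m)))
  rw [Finset.powerset_univ, Finset.card_fin] at h
  simp only [hc]
  rw [h, tsum_fintype]
  change _ = ∑ q : Finset.HasAntidiagonal.antidiagonal m, ((q : ℕ × ℕ).2.factorial : ENNReal)⁻¹ *
    (((q : ℕ × ℕ).1.factorial : ENNReal)⁻¹ * a (q : ℕ × ℕ).1 (q : ℕ × ℕ).2)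
  rw [Finset.sum_coe_sort (Finset.HasAntidiagonal.antidiagonal m) fun q : ℕ × ℕ =>
    (q.2.factorial : ENNReal)⁻¹ * ((q.1.factorial : ENNReal)⁻¹ * a q.1 q.2),
    Finset.Nat.sum_antidiagonal_eq_sum_range_succ_mk]
  refine Finset.sum_congr rfl fun n hn => ?_
  have hn' : n ≤ m := Nat.lt_succ_iff.1 (Finset.mem_range.1 hn)
  have hne : ((m.choose n : ℕ) : ENNReal) ≠ 0 := by exact_mod_cast (Nat.choose_pos hn').ne'
  rw [← Nat.choose_mul_factorial_mul_factorial hn', nsmul_eq_mul]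
  push_cast
  rw [ENNReal.mul_inv (.inr (ENNReal.natCast_ne_top _))
    (.inr (by exact_mod_cast (m - n).factorial_ne_zero)),
    ENNReal.mul_inv (.inl hne) (.inl (ENNReal.natCast_ne_top _)), ← mul_assoc, ← mul_assoc,
    ← mul_assoc, ENNReal.mul_inv_cancel hne (ENNReal.natCast_ne_top _), one_mul, ← mul_assoc,
    mul_comm (n.factorial : ENNReal)⁻¹]

/-- A pair of independent configurations is a configuration together with a splitting into
two parts. -/
theorem configMeasure_prod (I : Set ℝ) :
    (configMeasure I).prod (configMeasure I) =
      Measure.sum fun p : (Σ m : ℕ, Finset (Fin m)) =>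
        (p.1.factorial : ENNReal)⁻¹ • (cubeMeasure I p.1).map (splitConfig p.2) := by
  have h : ∀ p : (Σ m : ℕ, Finset (Fin m)), (cubeMeasure I p.1).map (splitConfig p.2) =
      ((cubeMeasure I p.2.card).prod (cubeMeasure I p.2ᶜ.card)).map
        (Prod.map (tuple p.2.card) (tuple p.2ᶜ.card)) := fun p => by
    rw [← (measurePreserving_splitEquiv I p.2).map_eq, Measure.map_map _ (splitEquiv _).measurable,
      ← splitConfig_eq]
    exact ((measurableEmbedding_tuple _).prodMap (measurableEmbedding_tuple _)).measurable
  simp only [h]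
  rw [configMeasure, Measure.prod_sum]
  ext s hs
  rw [Measure.sum_apply _ hs, Measure.sum_apply _ hs, ENNReal.tsum_sigma']
  simp only [Measure.prod_smul_left, Measure.prod_smul_right,
    Measure.map_prod_map _ _ (measurableEmbedding_tuple _).measurable
      (measurableEmbedding_tuple _).measurable, Measure.smul_apply, smul_eq_mul, tsum_fintype]
  exact (tsum_sum_finset_fin fun n k => (((cubeMeasure I n).prod (cubeMeasure I k)).map
    (Prod.map (tuple n) (tuple k))) s).symm

/-! ### The sum-integral formula -/

theorem sum_powerset_image {m : ℕ} {x : Fin m → ℝ} (hx : Function.Injective x) {M : Type*}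
    [AddCommMonoid M] (g : Finset ℝ → Finset ℝ → M) :
    ∑ S ∈ (Finset.univ.image x).powerset, g S (Finset.univ.image x \ S) =
      ∑ S : Finset (Fin m), g (S.image x) (Sᶜ.image x) := by
  rw [Finset.powerset_image, Finset.sum_image (Finset.image_injective hx).injOn,
    Finset.powerset_univ]
  refine Finset.sum_congr rfl fun S _ => ?_
  rw [← Finset.image_sdiff _ _ hx, Finset.compl_eq_univ_sdiff]

section Split

variable {I : Set ℝ}

/-- Permuting the coordinates only changes the index set `S` into `π(S)`, so testing all index sets
on increasing tuples suffices. -/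
theorem aestronglyMeasurable_split {E : Type*} [NormedAddCommGroup E]
    {G : Finset ℝ → Finset ℝ → E}
    (h : ∀ (m : ℕ) (S : Finset (Fin m)),
      AEStronglyMeasurable (fun x => G (S.image x) (Sᶜ.image x)) (orderedMeasure I m)) :
    AEStronglyMeasurable (fun p : Configuration × Configuration => G p.1.points p.2.points)
      ((configMeasure I).prod (configMeasure I)) := by
  rw [configMeasure_prod, aestronglyMeasurable_sum_measure_iff]
  rintro ⟨m, S⟩
  refine AEStronglyMeasurable.smul_measure
    ((measurableEmbedding_splitConfig S).aestronglyMeasurable_map_iff.2 ?_) _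
  simp only [Function.comp_def, splitConfig_fst_points, splitConfig_snd_points]
  refine aestronglyMeasurable_cube fun π => ?_
  convert h m (S.image π) using 2 with x
  have hc : (S.image π)ᶜ = Sᶜ.image π := Finset.coe_injective (by
    push_cast
    exact (Set.image_compl_eq π.bijective).symm)
  rw [hc, Finset.image_image, Finset.image_image]

theorem aestronglyMeasurable_cube_split {E : Type*} [NormedAddCommGroup E]
    {G : Finset ℝ → Finset ℝ → E}
    (hG : AEStronglyMeasurable (fun p : Configuration × Configuration => G p.1.points p.2.points)
      ((configMeasure I).prod (configMeasure I))) {m : ℕ} (S : Finset (Fin m)) :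
    AEStronglyMeasurable (fun x => G (S.image x) (Sᶜ.image x)) (cubeMeasure I m) := by
  rw [configMeasure_prod, aestronglyMeasurable_sum_measure_iff] at hG
  have h := (hG ⟨m, S⟩).smul_measure (m.factorial : ENNReal)
  rw [smul_smul, ENNReal.mul_inv_cancel (by exact_mod_cast m.factorial_ne_zero)
    (ENNReal.natCast_ne_top _), one_smul,
    (measurableEmbedding_splitConfig S).aestronglyMeasurable_map_iff] at h
  simpa only [Function.comp_def, splitConfig_fst_points, splitConfig_snd_points] using h

/-- The sum-integral formula for norms. Only measurability is required, so it can serve to prove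
finiteness. -/
theorem lintegral_enorm_split {E : Type*} [NormedAddCommGroup E] {G : Finset ℝ → Finset ℝ → E}
    (hG : AEStronglyMeasurable (fun p : Configuration × Configuration => G p.1.points p.2.points)
      ((configMeasure I).prod (configMeasure I))) :
    ∫⁻ p, ‖G p.1.points p.2.points‖ₑ ∂((configMeasure I).prod (configMeasure I)) =
      ∫⁻ ω, ∑ S ∈ ω.points.powerset, ‖G S (ω.points \ S)‖ₑ ∂(configMeasure I) := by
  rw [lintegral_configMeasure, configMeasure_prod, lintegral_sum_measure, ENNReal.tsum_sigma']
  refine tsum_congr fun m => ?_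
  simp only [lintegral_smul_measure, (measurableEmbedding_splitConfig _).lintegral_map,
    splitConfig_fst_points, splitConfig_snd_points, smul_eq_mul, tsum_fintype]
  rw [← Finset.mul_sum, ← lintegral_finsetSum' _ fun S _ =>
    (aestronglyMeasurable_cube_split hG S).enorm]
  congr 1
  refine lintegral_congr_ae ?_
  filter_upwards [ae_injective I m] with x hx
  exact (sum_powerset_image hx fun S S' => ‖G S S'‖ₑ).symm

/-- The sum-integral formula, as a statement on Dyson series. -/
theorem hasDysonSum_split {G : Finset ℝ → Finset ℝ → ℂ}
    (hG : Integrable (fun p : Configuration × Configuration => G p.1.points p.2.points)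
      ((configMeasure I).prod (configMeasure I))) :
    HasDysonSum I (fun _ x => ∑ S ∈ (Finset.univ.image x).powerset, G S (Finset.univ.image x \ S))
      (∫ p, G p.1.points p.2.points ∂((configMeasure I).prod (configMeasure I))) := by
  have hG' := hG
  rw [configMeasure_prod] at hG'
  have hc : ∀ (m : ℕ) (S : Finset (Fin m)),
      Integrable (fun x => G (S.image x) (Sᶜ.image x)) (cubeMeasure I m) := by
    intro m S
    have h := (integrable_sum_measure_iff.1 hG').1 ⟨m, S⟩
    rw [integrable_smul_measure (inv_factorial_ne_zero m) (inv_factorial_ne_top m),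
      (measurableEmbedding_splitConfig S).integrable_map_iff] at h
    simpa only [Function.comp_def, splitConfig_fst_points, splitConfig_snd_points] using h
  have hae : ∀ m : ℕ,
      (fun x : Fin m → ℝ => ∑ S : Finset (Fin m), G (S.image x) (Sᶜ.image x)) =ᵐ[cubeMeasure I m]
      fun x => ∑ S ∈ (Finset.univ.image x).powerset, G S (Finset.univ.image x \ S) := fun m => by
    filter_upwards [ae_injective I m] with x hx
    exact (sum_powerset_image hx G).symm
  have hi : ∀ m : ℕ, Integrable (fun x : Fin m → ℝ => ∑ S ∈ (Finset.univ.image x).powerset,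
      G S (Finset.univ.image x \ S)) (cubeMeasure I m) := fun m =>
    (integrable_finsetSum _ fun S _ => hc m S).congr (hae m)
  refine ⟨fun m => (hi m).mono_measure Measure.restrict_le_self, ?_⟩
  have h := hasSum_integral_measure hG'
  rw [← configMeasure_prod] at h
  -- The series over all splittings is grouped by the number `m` of points.
  refine (h.sigma fun m => hasSum_fintype _).congr_fun fun m => ?_
  have e : ∀ S : Finset (Fin m), ∫ p, G p.1.points p.2.points
      ∂((m.factorial : ENNReal)⁻¹ • (cubeMeasure I m).map (splitConfig S)) =
      (m.factorial : ℂ)⁻¹ * ∫ x, G (S.image x) (Sᶜ.image x) ∂(cubeMeasure I m) := fun S => by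
    rw [integral_smul_measure, (measurableEmbedding_splitConfig S).integral_map]
    simp [splitConfig_fst_points, splitConfig_snd_points]
  simp only [e]
  -- A single splitting is not symmetric in the coordinates, but the sum over all of them is; its
  -- cube integral is `m!` times the ordered one, cancelling the weight.
  rw [← Finset.mul_sum, ← integral_finsetSum _ fun S _ => hc m S, integral_congr_ae (hae m),
    integral_cube_of_symm (fun π x => ?_) (hi m), ← mul_assoc,
    inv_mul_cancel₀ (by exact_mod_cast m.factorial_ne_zero), one_mul]
  rw [← Finset.image_image, Finset.image_univ_equiv]

end Split

/-! ### Fock vectors as functions of configurations -/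

section Vectors

variable {I : Set ℝ}

theorem integrable_configMeasure_iff {E : Type*} [NormedAddCommGroup E]
    {f : Configuration → E} :
    Integrable f (configMeasure I) ↔
      (∀ m, Integrable (fun x => f ⟨m, x⟩) (cubeMeasure I m)) ∧
        Summable fun m : ℕ => (m.factorial : ℝ)⁻¹ * ∫ x, ‖f ⟨m, x⟩‖ ∂(cubeMeasure I m) := by
  rw [configMeasure, integrable_sum_measure_iff]
  have e : ∀ m : ℕ, ∫ ω, ‖f ω‖ ∂((m.factorial : ENNReal)⁻¹ • (cubeMeasure I m).map (tuple m)) =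
      (m.factorial : ℝ)⁻¹ * ∫ x, ‖f ⟨m, x⟩‖ ∂(cubeMeasure I m) := fun m => by
    rw [integral_smul_measure, (measurableEmbedding_tuple m).integral_map]
    simp
  simp only [e]
  refine and_congr (forall_congr' fun m => ?_) Iff.rfl
  rw [integrable_smul_measure (inv_factorial_ne_zero m) (inv_factorial_ne_top m),
    (measurableEmbedding_tuple m).integrable_map_iff]
  rfl

/-- Repeated coordinates collapse in `points`, so equality holds only off the diagonals. -/
theorem prod_points_ae {R : Type*} [CommMonoid R] (f : ℝ → R) (m : ℕ) :
    (fun x : Fin m → ℝ => ∏ i, f (x i)) =ᵐ[cubeMeasure I m]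
      fun x => ∏ t ∈ Configuration.points ⟨m, x⟩, f t := by
  filter_upwards [ae_injective I m] with x hx
  exact (Finset.prod_image hx.injOn).symm

/-- The `m`-point sector contributes `‖f‖₁ ^ m / m!`, a term of the exponential series. -/
theorem integrable_prod_points {f : ℝ → ℝ} (hf : Integrable f (volume.restrict I)) :
    Integrable (fun ω : Configuration => ∏ t ∈ ω.points, f t) (configMeasure I) := by
  refine integrable_configMeasure_iff.2 ⟨fun m => ?_, ?_⟩
  · exact (Integrable.fintype_prod fun _ => hf).congr (prod_points_ae f m)
  · have e : ∀ m : ℕ, ∫ x, ‖∏ t ∈ Configuration.points ⟨m, x⟩, f t‖ ∂(cubeMeasure I m) =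
        (∫ t, ‖f t‖ ∂(volume.restrict I)) ^ m := fun m => by
      have h := (prod_points_ae (I := I) f m).fun_comp norm
      simp only [Function.comp_def] at h
      rw [← integral_congr_ae h]
      simp only [norm_prod]
      rw [integral_fintype_prod_eq_prod (𝕜 := ℝ) (fun _ t => ‖f t‖)]
      simp
    simp only [e]
    simpa only [div_eq_inv_mul] using
      Real.summable_pow_div_factorial (∫ t, ‖f t‖ ∂(volume.restrict I))

theorem memLp_prod_points {f : ℝ → ℝ} (hf : MemLp f 2 (volume.restrict I)) :
    MemLp (fun ω : Configuration => ∏ t ∈ ω.points, f t) 2 (configMeasure I) := by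
  rw [memLp_two_iff_integrable_sq]
  · simpa only [← Finset.prod_pow] using
      integrable_prod_points ((memLp_two_iff_integrable_sq hf.1).1 hf)
  · refine aestronglyMeasurable_configMeasure fun m => ?_
    refine AEStronglyMeasurable.congr ?_ (prod_points_ae f m)
    refine Finset.aestronglyMeasurable_fun_prod _ fun i _ => ?_
    exact hf.1.comp_quasiMeasurePreserving (Measure.quasiMeasurePreserving_eval _ i)

/-- `config` evaluates at the increasing arrangement; bosonic symmetry extends this to almost every
arrangement. -/
theorem config_wave_ae (Ψ : Fock I) (n : ℕ) :
    ∀ᵐ x ∂(cubeMeasure I n), config (wave Ψ) (Configuration.points ⟨n, x⟩) =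
      (Real.sqrt (n.factorial) : ℂ) * wave Ψ n x := by
  refine ae_cube_of_forall_perm fun π => ?_
  filter_upwards [ae_strictMono I n, ae_restrict_of_ae ((Ψ n).2 π)] with x hx hπ
  rw [points_perm, config_eq (σ := Configuration.points ⟨n, x⟩) (wave Ψ) hx rfl]
  exact congrArg _ hπ.symm

theorem norm_sq_Lp {α : Type*} [MeasurableSpace α] {μ : Measure α} (f : Lp ℂ 2 μ) :
    ‖f‖ ^ 2 = ∫ x, ‖f x‖ ^ 2 ∂μ := by
  have h := inner_self_eq_norm_sq_to_K (𝕜 := ℂ) f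
  rw [L2.inner_def] at h
  simp only [inner_self_eq_norm_sq_to_K] at h
  have h' : ((∫ x, ‖f x‖ ^ 2 ∂μ : ℝ) : ℂ) = ((‖f‖ ^ 2 : ℝ) : ℂ) := by
    rw [← integral_complex_ofReal]
    push_cast
    exact h
  exact_mod_cast h'.symm

theorem sqrt_factorial_sq (n : ℕ) : Real.sqrt (n.factorial) ^ 2 = n.factorial :=
  Real.sq_sqrt (by positivity)

/-- The square of `√(n!)` cancels the weight `1/n!`, so the squared norm is `∑ ‖Ψ n‖ ^ 2`. -/
theorem memLp_config (Ψ : Fock I) :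
    MemLp (fun ω : Configuration => config (wave Ψ) ω.points) 2 (configMeasure I) := by
  have hm : ∀ n, AEStronglyMeasurable (wave Ψ n) (cubeMeasure I n) := fun n =>
    (Lp.memLp _).1
  rw [memLp_two_iff_integrable_sq_norm]
  · have hae : ∀ n : ℕ, (fun x => n.factorial * ‖wave Ψ n x‖ ^ 2) =ᵐ[cubeMeasure I n]
        fun x => ‖config (wave Ψ) (Configuration.points ⟨n, x⟩)‖ ^ 2 := fun n => by
      filter_upwards [config_wave_ae Ψ n] with x hx
      rw [hx, norm_mul, mul_pow, Complex.norm_real, Real.norm_eq_abs, sq_abs, sqrt_factorial_sq]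
    refine integrable_configMeasure_iff.2 ⟨fun n => ?_, ?_⟩
    · exact (((memLp_two_iff_integrable_sq_norm (hm n)).1 (Lp.memLp _)).const_mul _).congr (hae n)
    · have e : ∀ n : ℕ, (n.factorial : ℝ)⁻¹ *
          ∫ x, ‖‖config (wave Ψ) (Configuration.points ⟨n, x⟩)‖ ^ 2‖ ∂(cubeMeasure I n) =
          ‖Ψ n‖ ^ 2 := fun n => by
        simp only [norm_pow, norm_norm]
        rw [← integral_congr_ae (hae n), integral_const_mul, ← mul_assoc,
          inv_mul_cancel₀ (by exact_mod_cast n.factorial_ne_zero), one_mul]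
        exact (norm_sq_Lp _).symm
      simp only [e]
      simpa using (lp.memℓp Ψ).summable (by norm_num)
  · refine aestronglyMeasurable_configMeasure fun n => ?_
    refine AEStronglyMeasurable.congr ((hm n).const_mul (Real.sqrt (n.factorial) : ℂ)) ?_
    filter_upwards [config_wave_ae Ψ n] with x hx
    exact hx.symm

theorem aestronglyMeasurable_fiber {E : Type*} [NormedAddCommGroup E] {f : Configuration → E}
    (hf : AEStronglyMeasurable f (configMeasure I)) (m : ℕ) :
    AEStronglyMeasurable (fun x => f ⟨m, x⟩) (cubeMeasure I m) := by
  rw [configMeasure, aestronglyMeasurable_sum_measure_iff] at hf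
  have h := (hf m).smul_measure (m.factorial : ENNReal)
  rw [smul_smul, ENNReal.mul_inv_cancel (by exact_mod_cast m.factorial_ne_zero)
    (ENNReal.natCast_ne_top _), one_smul,
    (measurableEmbedding_tuple m).aestronglyMeasurable_map_iff] at h
  exact h

variable {F : Finset ℝ → ℂ}

theorem memLp_component (hF : MemLp (fun ω : Configuration => F ω.points) 2 (configMeasure I))
    (n : ℕ) : MemLp (fun x : Fin n → ℝ => (Real.sqrt (n.factorial) : ℂ)⁻¹ *
      F (Configuration.points ⟨n, x⟩)) 2 (cubeMeasure I n) := by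
  have hm := aestronglyMeasurable_fiber hF.1 n
  refine MemLp.const_mul ((memLp_two_iff_integrable_sq_norm hm).2 ?_) _
  exact (integrable_configMeasure_iff.1 ((memLp_two_iff_integrable_sq_norm hF.1).1 hF)).1 n

/-- The `n`-particle component of the Fock vector with values `F` on configurations. -/
def component (hF : MemLp (fun ω : Configuration => F ω.points) 2 (configMeasure I)) (n : ℕ) :
    sector I n :=
  ⟨(memLp_component hF n).toLp _, fun σ => by
    have h := (memLp_component hF n).coeFn_toLp
    refine ((quasiMeasurePreserving_comp I σ σ.injective).ae_eq_comp h).trans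
      (Filter.EventuallyEq.trans ?_ h.symm)
    filter_upwards with x
    exact congrArg _ (congrArg F (points_perm x σ))⟩

theorem component_ae (hF : MemLp (fun ω : Configuration => F ω.points) 2 (configMeasure I))
    (n : ℕ) : (component hF n : Lp ℂ 2 (cubeMeasure I n)) =ᵐ[cubeMeasure I n]
      fun x => (Real.sqrt (n.factorial) : ℂ)⁻¹ * F (Configuration.points ⟨n, x⟩) :=
  (memLp_component hF n).coeFn_toLp

theorem memℓp_component
    (hF : MemLp (fun ω : Configuration => F ω.points) 2 (configMeasure I)) :
    Memℓp (component hF) 2 := by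
  refine memℓp_gen ?_
  have h := (integrable_configMeasure_iff.1 ((memLp_two_iff_integrable_sq_norm hF.1).1 hF)).2
  convert h using 2 with n
  have e : ‖component hF n‖ ^ (2 : ENNReal).toReal = ‖component hF n‖ ^ 2 := by simp
  rw [e]
  refine (norm_sq_Lp (component hF n : Lp ℂ 2 (cubeMeasure I n))).trans ?_
  rw [← integral_const_mul]
  refine integral_congr_ae ?_
  filter_upwards [component_ae hF n] with x hx
  rw [hx, norm_mul, mul_pow, norm_inv, inv_pow, Complex.norm_real, Real.norm_eq_abs, sq_abs,
    sqrt_factorial_sq, norm_pow, norm_norm]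

/-- The Fock vector with values `F` on configurations. -/
def ofConfig (hF : MemLp (fun ω : Configuration => F ω.points) 2 (configMeasure I)) : Fock I :=
  ⟨component hF, memℓp_component hF⟩

theorem config_ofConfig_ae
    (hF : MemLp (fun ω : Configuration => F ω.points) 2 (configMeasure I)) (n : ℕ) :
    ∀ᵐ x ∂(cubeMeasure I n), config (wave (ofConfig hF)) (Configuration.points ⟨n, x⟩) =
      F (Configuration.points ⟨n, x⟩) := by
  filter_upwards [config_wave_ae (ofConfig hF) n, component_ae hF n] with x hx hx'
  have hne : (Real.sqrt (n.factorial) : ℂ) ≠ 0 := by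
    exact_mod_cast (Real.sqrt_pos.2 (by positivity)).ne'
  rw [hx]
  refine (congrArg _ hx').trans ?_
  rw [mul_inv_cancel_left₀ hne]

/-- In each sector, `1/n!` times the `√(n!)` of `Ψ` is the `1/√(n!)` in the component built from
`F`. -/
theorem inner_ofConfig (Ψ : Fock I)
    (hF : MemLp (fun ω : Configuration => F ω.points) 2 (configMeasure I)) :
    inner ℂ Ψ (ofConfig hF) =
      ∫ ω, conj (config (wave Ψ) ω.points) * F ω.points ∂(configMeasure I) := by
  have hi : Integrable (fun ω => conj (config (wave Ψ) ω.points) * F ω.points)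
      (configMeasure I) := (memLp_config Ψ).star.integrable_mul hF
  refine (lp.hasSum_inner Ψ (ofConfig hF)).unique ?_
  refine (hasSum_integral_configMeasure hi).congr_fun fun n => ?_
  refine (L2.inner_def (𝕜 := ℂ) (Ψ n : Lp ℂ 2 (cubeMeasure I n))
    (ofConfig hF n : Lp ℂ 2 (cubeMeasure I n))).trans ?_
  rw [← integral_const_mul]
  refine integral_congr_ae ?_
  filter_upwards [config_wave_ae Ψ n, component_ae hF n] with x hx hx'
  have hne : (Real.sqrt (n.factorial) : ℂ) ≠ 0 := by
    exact_mod_cast (Real.sqrt_pos.2 (by positivity)).ne'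
  have hs : (n.factorial : ℂ) = (Real.sqrt (n.factorial) : ℂ) * Real.sqrt (n.factorial) := by
    have := sqrt_factorial_sq n
    rw [sq] at this
    exact_mod_cast this.symm
  have e₁ : ((Ψ n : Lp ℂ 2 (cubeMeasure I n)) : _ → ℂ) x = wave Ψ n x := rfl
  have e₂ : ((ofConfig hF n : Lp ℂ 2 (cubeMeasure I n)) : _ → ℂ) x =
      (Real.sqrt (n.factorial) : ℂ)⁻¹ * F (Configuration.points ⟨n, x⟩) := hx'
  rw [hx, e₁, e₂, RCLike.inner_apply, map_mul, Complex.conj_ofReal, hs]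
  field_simp

end Vectors

/-! ### Bounds and measurability of path-ordered products -/

/-- The sum of the absolute values of the entries of a matrix. -/
def entrySum {ι : Type*} [Fintype ι] (A : Matrix ι ι ℂ) : ℝ := ∑ i, ∑ j, ‖A i j‖

section EntrySum

variable {ι : Type*} [Fintype ι]

theorem entrySum_nonneg (A : Matrix ι ι ℂ) : 0 ≤ entrySum A :=
  Finset.sum_nonneg fun _ _ => Finset.sum_nonneg fun _ _ => norm_nonneg _

theorem norm_mul_apply_le (A X : Matrix ι ι ℂ) {c : ℝ} (hX : ∀ i j, ‖X i j‖ ≤ c) (i j : ι) :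
    ‖(A * X) i j‖ ≤ (∑ k, ‖A i k‖) * c := by
  rw [Matrix.mul_apply, Finset.sum_mul]
  refine (norm_sum_le _ _).trans (Finset.sum_le_sum fun k _ => ?_)
  rw [norm_mul]
  exact mul_le_mul_of_nonneg_left (hX k j) (norm_nonneg _)

/-- Entries of a product are bounded by a row sum of the first factor times the largest entry of the
rest, and `entrySum` dominates every row sum. -/
theorem norm_orderedProd_apply_le [DecidableEq ι] (f : ℝ → Matrix ι ι ℂ) (σ : Finset ℝ) :
    ∀ i j, ‖orderedProd f σ i j‖ ≤ orderedProd (fun t => entrySum (f t)) σ := by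
  induction σ using Finset.induction_on_min with
  | empty =>
    intro i j
    by_cases h : i = j
    · subst h; simp
    · simp [h]
  | insert a σ ha ih =>
    intro i j
    rw [orderedProd_insert _ ha, orderedProd_insert _ ha]
    refine (norm_mul_apply_le _ _ ih i j).trans (mul_le_mul_of_nonneg_right ?_
      (orderedProd_nonneg (fun t => entrySum_nonneg _) σ))
    exact Finset.single_le_sum (f := fun i => ∑ k, ‖f a i k‖)
      (fun i _ => Finset.sum_nonneg fun _ _ => norm_nonneg _) (Finset.mem_univ i)

theorem norm_trace_orderedProd_le [DecidableEq ι] (B : Matrix ι ι ℂ) (f : ℝ → Matrix ι ι ℂ)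
    (σ : Finset ℝ) :
    ‖(B * orderedProd f σ).trace‖ ≤ entrySum B * orderedProd (fun t => entrySum (f t)) σ := by
  rw [Matrix.trace, entrySum, Finset.sum_mul]
  exact (norm_sum_le _ _).trans (Finset.sum_le_sum fun i _ =>
    norm_mul_apply_le _ _ (norm_orderedProd_apply_le f σ) i i)

theorem entrySum_pick (S : Finset ℝ) (f g : ℝ → Matrix ι ι ℂ) :
    (fun t => entrySum (pick S f g t)) =
      pick S (fun t => entrySum (f t)) fun t => entrySum (g t) := by
  funext t
  simp only [pick]
  split_ifs <;> rfl

theorem entrySum_pickFour (S U : Finset ℝ) (Q L R T : ℝ → Matrix ι ι ℂ) :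
    (fun t => entrySum (pickFour S U Q L R T t)) =
      pickFour S U (fun t => entrySum (Q t)) (fun t => entrySum (L t))
        (fun t => entrySum (R t)) fun t => entrySum (T t) := by
  funext t
  simp only [pickFour]
  split_ifs <;> rfl

theorem memLp_entrySum {I : Set ℝ} {p : ENNReal} {A : ℝ → Matrix ι ι ℂ}
    (h : ∀ i j, MemLp (fun x => A x i j) p (volume.restrict I)) :
    MemLp (fun x => entrySum (A x)) p (volume.restrict I) :=
  memLp_finsetSum _ fun i _ => memLp_finsetSum _ fun j _ => (h i j).norm

theorem integrable_prod_entrySum {I : Set ℝ} {A : ℝ → Matrix ι ι ℂ}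
    (h : ∀ i j, MemLp (fun x => A x i j) 1 (volume.restrict I)) :
    Integrable (fun ω : Configuration => ∏ t ∈ ω.points, entrySum (A t)) (configMeasure I) :=
  integrable_prod_points (memLp_one_iff_integrable.1 (memLp_entrySum h))

end EntrySum

theorem orderedProd_pick_union {R : Type*} [CommMonoid R] (f g : ℝ → R) {α β : Finset ℝ}
    (h : Disjoint α β) :
    orderedProd (pick α f g) (α ∪ β) = (∏ t ∈ α, f t) * ∏ t ∈ β, g t := by
  rw [orderedProd_eq_prod, Finset.prod_union h]
  congr 1
  · exact Finset.prod_congr rfl fun t ht => by simp [pick, ht]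
  · exact Finset.prod_congr rfl fun t ht => by simp [pick, Finset.disjoint_right.1 h ht]

theorem sort_image {m : ℕ} {x : Fin m → ℝ} (hx : StrictMono x) (S : Finset (Fin m)) :
    (S.image x).sort (· ≤ ·) = (S.sort (· ≤ ·)).map x := by
  refine List.Perm.eq_of_pairwise' (r := (· ≤ ·)) (Finset.pairwise_sort _ _) ?_ ?_
  · exact List.pairwise_map.2 ((Finset.pairwise_sort S _).imp fun h => hx.monotone h)
  · refine (List.perm_ext_iff_of_nodup (Finset.sort_nodup _ _)
      ((Finset.sort_nodup _ _).map hx.injective)).2 fun t => ?_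
    simp

section Measurability

variable {I : Set ℝ} {ι : Type*} [Fintype ι] [DecidableEq ι]

theorem aestronglyMeasurable_list_prod {X : Type*} [MeasurableSpace X] {μ : Measure X}
    {κ : Type*} {A : κ → X → Matrix ι ι ℂ}
    (hA : ∀ a i j, AEStronglyMeasurable (fun x => A a x i j) μ) (l : List κ) :
    ∀ i j, AEStronglyMeasurable (fun x => (l.map fun a => A a x).prod i j) μ := by
  induction l with
  | nil => intro i j; simpa using aestronglyMeasurable_const
  | cons a l ih =>
    intro i j
    simp only [List.map_cons, List.prod_cons, Matrix.mul_apply]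
    exact Finset.aestronglyMeasurable_fun_sum _ fun k _ => (hA a i k).mul (ih k j)

/-- On increasing tuples the points are ordered as their indices, so the product has a fixed pattern
of factors, each depending on one coordinate. By `hfg`, the choice of tensor depends on the index
only. -/
theorem aestronglyMeasurable_trace_orderedProd (B : Matrix ι ι ℂ) {m : ℕ} (S : Finset (Fin m))
    {f : (Fin m → ℝ) → ℝ → Matrix ι ι ℂ} {g : Fin m → ℝ → Matrix ι ι ℂ}
    (hg : ∀ a i j, AEStronglyMeasurable (fun t => g a t i j) (volume.restrict I))
    (hfg : ∀ x, StrictMono x → ∀ a, f x (x a) = g a (x a)) :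
    AEStronglyMeasurable (fun x => (B * orderedProd (f x) (S.image x)).trace)
      (orderedMeasure I m) := by
  have h := aestronglyMeasurable_list_prod (μ := orderedMeasure I m)
    (A := fun a (x : Fin m → ℝ) => g a (x a)) (fun a i j =>
      ((hg a i j).comp_quasiMeasurePreserving
        (Measure.quasiMeasurePreserving_eval (fun _ => volume.restrict I) a)).mono_measure
        Measure.restrict_le_self) (S.sort (· ≤ ·))
  have h' : AEStronglyMeasurable (fun x : Fin m → ℝ =>
      (B * ((S.sort (· ≤ ·)).map fun a => g a (x a)).prod).trace) (orderedMeasure I m) := by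
    simp only [Matrix.trace, Matrix.diag, Matrix.mul_apply]
    exact Finset.aestronglyMeasurable_fun_sum _ fun i _ =>
      Finset.aestronglyMeasurable_fun_sum _ fun k _ => (h k i).const_mul _
  refine h'.congr ?_
  filter_upwards [ae_strictMono I m] with x hx
  simp only [orderedProd, sort_image hx, List.map_map, Function.comp_def, hfg x hx]

theorem image_comp_orderEmbOfFin {m : ℕ} (S : Finset (Fin m)) (x : Fin m → ℝ) :
    Finset.univ.image (x ∘ S.orderEmbOfFin rfl) = S.image x :=
  splitConfig_fst_points S x

theorem config_image (φ : Wave) {m : ℕ} (S : Finset (Fin m)) {x : Fin m → ℝ} (hx : StrictMono x) :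
    config φ (S.image x) =
      (Real.sqrt (S.card.factorial) : ℂ) * φ S.card (x ∘ S.orderEmbOfFin rfl) :=
  config_eq φ (hx.comp (S.orderEmbOfFin rfl).strictMono) (image_comp_orderEmbOfFin S x)

theorem aestronglyMeasurable_config (Ψ : Fock I) {m : ℕ} (S : Finset (Fin m)) :
    AEStronglyMeasurable (fun x => config (wave Ψ) (S.image x)) (orderedMeasure I m) := by
  have h : AEStronglyMeasurable (wave Ψ S.card) (cubeMeasure I S.card) := (Lp.memLp _).1
  have h' := ((h.comp_quasiMeasurePreserving (quasiMeasurePreserving_comp I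
    (S.orderEmbOfFin rfl) (S.orderEmbOfFin rfl).injective)).mono_measure
    (ν := orderedMeasure I m) Measure.restrict_le_self).const_mul
    (Real.sqrt (S.card.factorial) : ℂ)
  refine h'.congr ?_
  filter_upwards [ae_strictMono I m] with x hx
  exact (config_image (wave Ψ) S hx).symm

end Measurability

theorem HasDysonSum.congr {I : Set ℝ} {F F' : (m : ℕ) → (Fin m → ℝ) → ℂ} {s : ℂ}
    (h : HasDysonSum I F s) (hF : ∀ m, F m =ᵐ[orderedMeasure I m] F' m) :
    HasDysonSum I F' s := by
  refine ⟨fun m => (h.1 m).congr (hF m), ?_⟩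
  simp only [← fun m => integral_congr_ae (hF m)]
  exact h.2

theorem HasDysonSum.congr_strictMono {I : Set ℝ} {F F' : (m : ℕ) → (Fin m → ℝ) → ℂ} {s : ℂ}
    (h : HasDysonSum I F s) (hF : ∀ m x, StrictMono x → F m x = F' m x) :
    HasDysonSum I F' s :=
  h.congr fun m => by
    filter_upwards [ae_strictMono I m] with x hx
    exact hF m x hx

/-! ### Existence of continuous matrix product states -/

section State

variable {I : Set ℝ} {ι : Type} [Fintype ι] [DecidableEq ι]

/-- `Tr_D(B ∏ …)` for the path-ordered product over `α ∪ β` with factors `L` at the points of `α`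
and `Q` at the points of `β`. -/
def stateKernel (B : Matrix ι ι ℂ) (Q L : ℝ → Matrix ι ι ℂ) (α β : Finset ℝ) : ℂ :=
  -- Overlapping pairs are a null set; the value `0` there makes the factorised bound hold for all
  -- pairs.
  if Disjoint α β then (B * orderedProd (pick α L Q) (α ∪ β)).trace else 0

/-- The value of a cMPS on the configuration `α`. -/
def stateConfig (I : Set ℝ) (B : Matrix ι ι ℂ) (Q L : ℝ → Matrix ι ι ℂ) (α : Finset ℝ) : ℂ :=
  ∫ ω, stateKernel B Q L α ω.points ∂(configMeasure I)

variable (B : Matrix ι ι ℂ) {Q L : ℝ → Matrix ι ι ℂ}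

theorem norm_stateKernel_le (Q L : ℝ → Matrix ι ι ℂ) (α β : Finset ℝ) :
    ‖stateKernel B Q L α β‖ ≤
      entrySum B * (∏ t ∈ α, entrySum (L t)) * ∏ t ∈ β, entrySum (Q t) := by
  unfold stateKernel
  split_ifs with h
  · refine (norm_trace_orderedProd_le _ _ _).trans_eq ?_
    rw [entrySum_pick, orderedProd_pick_union _ _ h, mul_assoc]
  · rw [norm_zero]
    exact mul_nonneg (mul_nonneg (entrySum_nonneg _) (Finset.prod_nonneg fun _ _ =>
      entrySum_nonneg _)) (Finset.prod_nonneg fun _ _ => entrySum_nonneg _)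

theorem aestronglyMeasurable_stateKernel_image (h : StateTensors I Q L) {m : ℕ}
    {S S' : Finset (Fin m)} (hS : Disjoint S S') :
    AEStronglyMeasurable (fun x => stateKernel B Q L (S.image x) (S'.image x))
      (orderedMeasure I m) := by
  have h1 := aestronglyMeasurable_trace_orderedProd (I := I) B (S ∪ S')
    (f := fun x => pick (S.image x) L Q) (g := fun a => if a ∈ S then L else Q)
    (fun a i j => by
      split_ifs
      · exact (h.2 i j).1
      · exact (h.1 i j).1)
    (fun x hx a => by
      simp only [pick, hx.injective.mem_finset_image]
      split_ifs <;> rfl)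
  refine h1.congr ?_
  filter_upwards [ae_strictMono I m] with x hx
  rw [stateKernel, if_pos ((Finset.disjoint_image hx.injective).2 hS), Finset.image_union]

theorem aestronglyMeasurable_stateKernel (h : StateTensors I Q L) :
    AEStronglyMeasurable
      (fun p : Configuration × Configuration => stateKernel B Q L p.1.points p.2.points)
      ((configMeasure I).prod (configMeasure I)) :=
  aestronglyMeasurable_split fun _ _ =>
    aestronglyMeasurable_stateKernel_image B h disjoint_compl_right

theorem integrable_stateKernel_ae (h : StateTensors I Q L) :
    ∀ᵐ ω ∂(configMeasure I), Integrable
      (fun ω' : Configuration => stateKernel B Q L ω.points ω'.points) (configMeasure I) := by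
  filter_upwards [(aestronglyMeasurable_stateKernel B h).prodMk_left] with ω hω
  exact ((integrable_prod_entrySum h.1).const_mul
    (entrySum B * ∏ t ∈ ω.points, entrySum (L t))).mono' hω
    (.of_forall fun ω' => norm_stateKernel_le B Q L ω.points ω'.points)

theorem norm_stateConfig_le (h : StateTensors I Q L) (α : Finset ℝ) :
    ‖stateConfig I B Q L α‖ ≤
      (entrySum B * ∫ ω, ∏ t ∈ ω.points, entrySum (Q t) ∂(configMeasure I)) *
        ∏ t ∈ α, entrySum (L t) := by
  refine (norm_integral_le_of_norm_le ((integrable_prod_entrySum h.1).const_mul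
    (entrySum B * ∏ t ∈ α, entrySum (L t)))
    (.of_forall fun ω => norm_stateKernel_le B Q L α ω.points)).trans_eq ?_
  rw [integral_const_mul]
  ring

/-- Integrating out the `Q`-points costs only a constant, and the remaining majorant `∏ entrySum (L
t)` is in `L²` on configurations. -/
theorem memLp_stateConfig (h : StateTensors I Q L) :
    MemLp (fun ω : Configuration => stateConfig I B Q L ω.points) 2 (configMeasure I) := by
  refine MemLp.of_le_mul
    (c := entrySum B * ∫ ω, ∏ t ∈ ω.points, entrySum (Q t) ∂(configMeasure I))
    (memLp_prod_points (memLp_entrySum h.2))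
    (aestronglyMeasurable_stateKernel B h).integral_prod_right'
    (.of_forall fun ω => (norm_stateConfig_le B h ω.points).trans_eq ?_)
  rw [Real.norm_of_nonneg (Finset.prod_nonneg fun _ _ => entrySum_nonneg _)]

/-- The Fock vector `|ψ[B,Q,L]⟩`. -/
def stateVector (h : StateTensors I Q L) : Fock I := ofConfig (memLp_stateConfig B h)

/-- Cauchy–Schwarz in the first configuration, and an independent `L¹` factor in the second. It
dominates both the state and the operator kernels. -/
theorem integrable_bound (Ψ : Fock I) {ℓ q : ℝ → ℝ} (hℓ : MemLp ℓ 2 (volume.restrict I))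
    (hq : Integrable q (volume.restrict I)) :
    Integrable (fun p : Configuration × Configuration => ‖config (wave Ψ) p.1.points‖ *
      (∏ t ∈ p.1.points, ℓ t) * ∏ t ∈ p.2.points, q t)
      ((configMeasure I).prod (configMeasure I)) :=
  ((memLp_config Ψ).norm.integrable_mul (memLp_prod_points hℓ)).mul_prod
    (integrable_prod_points hq)

/-- By Fubini the inner product is an integral over pairs; the sum-integral formula merges each pair
into one configuration, and the splittings become the choices of `S` in the Dyson integrand. -/
theorem isCMPS_stateVector (h : StateTensors I Q L) : IsCMPS I B Q L (stateVector B h) := by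
  intro Ψ _
  have hi : Integrable (fun p : Configuration × Configuration =>
      conj (config (wave Ψ) p.1.points) * stateKernel B Q L p.1.points p.2.points)
      ((configMeasure I).prod (configMeasure I)) := by
    refine ((integrable_bound Ψ (memLp_entrySum h.2)
      (memLp_one_iff_integrable.1 (memLp_entrySum h.1))).const_mul (entrySum B)).mono'
      ?_ (.of_forall fun p => ?_)
    · exact (memLp_config Ψ).star.1.comp_fst.mul (aestronglyMeasurable_stateKernel B h)
    · rw [norm_mul, RCLike.norm_conj]
      refine (mul_le_mul_of_nonneg_left (norm_stateKernel_le B Q L _ _)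
        (norm_nonneg _)).trans_eq ?_
      ring
  have e : inner ℂ Ψ (stateVector B h) = ∫ p : Configuration × Configuration,
      conj (config (wave Ψ) p.1.points) * stateKernel B Q L p.1.points p.2.points
      ∂((configMeasure I).prod (configMeasure I)) := by
    rw [integral_prod _ hi]
    simp only [integral_const_mul]
    exact inner_ofConfig Ψ (memLp_stateConfig B h)
  rw [e]
  refine (hasDysonSum_split (G := fun α β => conj (config (wave Ψ) α) * stateKernel B Q L α β)
    hi).congr_strictMono fun m x hx => ?_
  rw [stateIntegrand_eq B Q L hx]
  refine Finset.sum_congr rfl fun S hS => ?_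
  rw [stateKernel, if_pos Finset.disjoint_sdiff,
    Finset.union_sdiff_of_subset (Finset.mem_powerset.1 hS)]

theorem IsCMPS.unique {B : Matrix ι ι ℂ} {Φ Φ' : Fock I} (h : IsCMPS I B Q L Φ)
    (h' : IsCMPS I B Q L Φ') : Φ = Φ' :=
  ext_finiteParticle fun Ψ hΨ => (h Ψ hΨ).2.unique (h' Ψ hΨ).2

end State

/-! ### The tensors of the image state -/

section Kronecker

variable {ι₁ ι₂ : Type*} [Fintype ι₁] [DecidableEq ι₁] [Fintype ι₂] [DecidableEq ι₂]

/-- `A ↦ A ⊗ 1`. -/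
def kroneckerOne (ι₁ ι₂ : Type*) [Fintype ι₁] [DecidableEq ι₁] [Fintype ι₂] [DecidableEq ι₂] :
    Matrix ι₁ ι₁ ℂ →* Matrix (ι₁ × ι₂) (ι₁ × ι₂) ℂ where
  toFun A := A ⊗ₖ 1
  map_one' := Matrix.one_kronecker_one
  map_mul' A A' := by rw [← Matrix.mul_kronecker_mul, one_mul]

/-- `A ↦ 1 ⊗ A`. -/
def oneKronecker (ι₁ ι₂ : Type*) [Fintype ι₁] [DecidableEq ι₁] [Fintype ι₂] [DecidableEq ι₂] :
    Matrix ι₂ ι₂ ℂ →* Matrix (ι₁ × ι₂) (ι₁ × ι₂) ℂ where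
  toFun A := 1 ⊗ₖ A
  map_one' := Matrix.one_kronecker_one
  map_mul' A A' := by rw [← Matrix.mul_kronecker_mul, one_mul]

theorem kroneckerOne_mul_oneKronecker (A : Matrix ι₁ ι₁ ℂ) (A' : Matrix ι₂ ι₂ ℂ) :
    kroneckerOne ι₁ ι₂ A * oneKronecker ι₁ ι₂ A' = A ⊗ₖ A' := by
  change A ⊗ₖ 1 * 1 ⊗ₖ A' = _
  rw [← Matrix.mul_kronecker_mul, mul_one, one_mul]

theorem commute_oneKronecker_kroneckerOne (A : Matrix ι₁ ι₁ ℂ) (A' : Matrix ι₂ ι₂ ℂ) :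
    Commute (oneKronecker ι₁ ι₂ A') (kroneckerOne ι₁ ι₂ A) := by
  change 1 ⊗ₖ A' * A ⊗ₖ 1 = A ⊗ₖ 1 * 1 ⊗ₖ A'
  rw [← Matrix.mul_kronecker_mul, ← Matrix.mul_kronecker_mul, mul_one, one_mul, mul_one, one_mul]

/-- Pairs of path-ordered products of the operator and of the state recombine into path-ordered
products of the tensors of the image state. -/
theorem sum_trace_mul_trace (B₁ : Matrix ι₁ ι₁ ℂ) (Q₁ L₁ R₁ T₁ : ℝ → Matrix ι₁ ι₁ ℂ)
    (B₂ : Matrix ι₂ ι₂ ℂ) (Q₂ L₂ : ℝ → Matrix ι₂ ι₂ ℂ) (c : Finset ℝ → ℂ) (ρ : Finset ℝ) :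
    ∑ σ ∈ ρ.powerset, ∑ S ∈ σ.powerset, ∑ U ∈ σ.powerset,
      c S * ((B₁ * orderedProd (pickFour S U Q₁ L₁ R₁ T₁) σ).trace *
        (B₂ * orderedProd (pick U L₂ Q₂) (U ∪ (ρ \ σ))).trace) =
    ∑ S ∈ ρ.powerset, c S * ((B₁ ⊗ₖ B₂) * orderedProd
      (pick S (fun x => L₁ x ⊗ₖ (1 : Matrix ι₂ ι₂ ℂ) + T₁ x ⊗ₖ L₂ x)
        (fun x => Q₁ x ⊗ₖ (1 : Matrix ι₂ ι₂ ℂ) + (1 : Matrix ι₁ ι₁ ℂ) ⊗ₖ Q₂ x +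
          R₁ x ⊗ₖ L₂ x)) ρ).trace := by
  set k₁ := kroneckerOne ι₁ ι₂ with hk₁
  set k₂ := oneKronecker ι₁ ι₂ with hk₂
  have hfour : ∀ S U, (fun t => k₁ (pickFour S U Q₁ L₁ R₁ T₁ t)) =
      pickFour S U (fun t => k₁ (Q₁ t)) (fun t => k₁ (L₁ t)) (fun t => k₁ (R₁ t))
        fun t => k₁ (T₁ t) := by
    intro S U
    funext t
    simp only [pickFour]
    split_ifs <;> rfl
  have hpick : ∀ U, (fun t => k₂ (pick U L₂ Q₂ t)) =
      pick U (fun t => k₂ (L₂ t)) fun t => k₂ (Q₂ t) := by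
    intro U
    funext t
    simp only [pick]
    split_ifs <;> rfl
  have hcomm : ∀ (A : Matrix ι₂ ι₂ ℂ) S U t, Commute (k₂ A)
      (pickFour S U (fun t => k₁ (Q₁ t)) (fun t => k₁ (L₁ t)) (fun t => k₁ (R₁ t))
        (fun t => k₁ (T₁ t)) t) := fun A S U t => by
    rw [← hfour]
    exact commute_oneKronecker_kroneckerOne _ _
  have key := sum_orderedProd_mul (fun t => k₁ (Q₁ t)) (fun t => k₁ (L₁ t)) (fun t => k₁ (R₁ t))
    (fun t => k₁ (T₁ t)) (fun t => k₂ (Q₂ t)) (fun t => k₂ (L₂ t)) (fun s => hcomm (Q₂ s))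
    (fun s => hcomm (L₂ s)) ρ c
  simp only [← hfour, ← hpick, ← map_orderedProd] at key
  simp only [hk₁, hk₂, kroneckerOne_mul_oneKronecker] at key
  -- Multiplying by `B₁ ⊗ₖ B₂` and taking the trace factorises each left-hand term, since the trace
  -- is multiplicative on Kronecker products.
  have key' := congrArg (fun X => ((B₁ ⊗ₖ B₂) * X).trace) key
  simp only [Finset.mul_sum, Matrix.trace_sum, Matrix.mul_smul, Matrix.trace_smul, smul_eq_mul,
    ← Matrix.mul_kronecker_mul, Matrix.trace_kronecker] at key'
  exact key'

/-- Hölder: `R₁L₂` is a product of two `L²` functions, hence in `L¹`, and `T₁L₂` is `L^∞` times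
`L²`, hence in `L²`. -/
theorem stateTensors_kronecker {I : Set ℝ} {ι₁ ι₂ : Type} [Fintype ι₁] [DecidableEq ι₁]
    [Fintype ι₂] [DecidableEq ι₂] {Q₁ L₁ R₁ T₁ : ℝ → Matrix ι₁ ι₁ ℂ}
    {Q₂ L₂ : ℝ → Matrix ι₂ ι₂ ℂ} (h₁ : OperatorTensors I Q₁ L₁ R₁ T₁)
    (h₂ : StateTensors I Q₂ L₂) :
    StateTensors I
      (fun x => Q₁ x ⊗ₖ (1 : Matrix ι₂ ι₂ ℂ) + (1 : Matrix ι₁ ι₁ ℂ) ⊗ₖ Q₂ x + R₁ x ⊗ₖ L₂ x)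
      (fun x => L₁ x ⊗ₖ (1 : Matrix ι₂ ι₂ ℂ) + T₁ x ⊗ₖ L₂ x) := by
  obtain ⟨⟨hQ₁, hL₁⟩, hR₁, hT₁⟩ := h₁
  obtain ⟨hQ₂, hL₂⟩ := h₂
  refine ⟨fun i j => ?_, fun i j => ?_⟩
  · simp only [Matrix.add_apply, Matrix.kroneckerMap_apply]
    exact (((hQ₁ _ _).mul_const _).add ((hQ₂ _ _).const_mul _)).add
      (MemLp.mul' (hL₂ _ _) (hR₁ _ _))
  · simp only [Matrix.add_apply, Matrix.kroneckerMap_apply]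
    exact ((hL₁ _ _).mul_const _).add (MemLp.mul' (hL₂ _ _) (hT₁ _ _))

end Kronecker

/-! ### The action of a continuous matrix product operator -/

section Operator

variable {I : Set ℝ} {ι₁ ι₂ : Type} [Fintype ι₁] [DecidableEq ι₁] [Fintype ι₂] [DecidableEq ι₂]
  (B₁ : Matrix ι₁ ι₁ ℂ) {Q₁ L₁ R₁ T₁ : ℝ → Matrix ι₁ ι₁ ℂ} (B₂ : Matrix ι₂ ι₂ ℂ)
  {Q₂ L₂ : ℝ → Matrix ι₂ ι₂ ℂ}

/-- The integrand of `⟨ψ|O₁|ψ[B₂,Q₂,L₂]⟩`: the operator acts at the points of `σ`, and `β` are the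
points where the state contributes `Q₂`. -/
def actionKernel (B₁ : Matrix ι₁ ι₁ ℂ) (Q₁ L₁ R₁ T₁ : ℝ → Matrix ι₁ ι₁ ℂ) (B₂ : Matrix ι₂ ι₂ ℂ)
    (Q₂ L₂ : ℝ → Matrix ι₂ ι₂ ℂ) (ψ : Wave) (σ β : Finset ℝ) : ℂ :=
  ∑ S ∈ σ.powerset, ∑ U ∈ σ.powerset, conj (config ψ S) *
    ((B₁ * orderedProd (pickFour S U Q₁ L₁ R₁ T₁) σ).trace * stateKernel B₂ Q₂ L₂ U β)

theorem aestronglyMeasurable_actionKernel (h₁ : OperatorTensors I Q₁ L₁ R₁ T₁)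
    (h₂ : StateTensors I Q₂ L₂) (Ψ : Fock I) :
    AEStronglyMeasurable (fun p : Configuration × Configuration =>
      actionKernel B₁ Q₁ L₁ R₁ T₁ B₂ Q₂ L₂ (wave Ψ) p.1.points p.2.points)
      ((configMeasure I).prod (configMeasure I)) := by
  refine aestronglyMeasurable_split fun m A => ?_
  have hop : ∀ S U : Finset (Fin m), AEStronglyMeasurable (fun x : Fin m → ℝ =>
      (B₁ * orderedProd (pickFour (S.image x) (U.image x) Q₁ L₁ R₁ T₁) (A.image x)).trace)
      (orderedMeasure I m) := fun S U =>
    aestronglyMeasurable_trace_orderedProd (I := I) B₁ A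
      (f := fun x => pickFour (S.image x) (U.image x) Q₁ L₁ R₁ T₁)
      (g := fun a => if a ∈ S then if a ∈ U then T₁ else L₁ else if a ∈ U then R₁ else Q₁)
      (fun a i j => by
        split_ifs
        · exact (h₁.2.2 i j).1
        · exact (h₁.1.2 i j).1
        · exact (h₁.2.1 i j).1
        · exact (h₁.1.1 i j).1)
      (fun x hx a => by
        simp only [pickFour, hx.injective.mem_finset_image]
        split_ifs <;> rfl)
  have hsum : AEStronglyMeasurable (fun x : Fin m → ℝ =>
      ∑ S ∈ A.powerset, ∑ U ∈ A.powerset, conj (config (wave Ψ) (S.image x)) *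
        ((B₁ * orderedProd (pickFour (S.image x) (U.image x) Q₁ L₁ R₁ T₁) (A.image x)).trace *
          stateKernel B₂ Q₂ L₂ (U.image x) (Aᶜ.image x))) (orderedMeasure I m) := by
    refine Finset.aestronglyMeasurable_fun_sum _ fun S _ =>
      Finset.aestronglyMeasurable_fun_sum _ fun U hU => ?_
    exact (Complex.continuous_conj.comp_aestronglyMeasurable (aestronglyMeasurable_config Ψ S)).mul
      ((hop S U).mul (aestronglyMeasurable_stateKernel_image B₂ h₂
        (Finset.disjoint_of_subset_left (Finset.mem_powerset.1 hU) disjoint_compl_right)))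
  refine hsum.congr ?_
  filter_upwards [ae_strictMono I m] with x hx
  have hinj := (Finset.image_injective hx.injective).injOn (s := (A.powerset : Set (Finset (Fin m))))
  rw [actionKernel, Finset.powerset_image, Finset.sum_image hinj]
  refine Finset.sum_congr rfl fun S _ => ?_
  rw [Finset.sum_image hinj]

/-- The recombination identity is applied to the real majorants `entrySum`, where commutation is
automatic; it resums the choices of `σ` and `U` into the majorants of the product tensors. -/
theorem norm_actionKernel_le (Q₁ L₁ R₁ T₁ : ℝ → Matrix ι₁ ι₁ ℂ) (Q₂ L₂ : ℝ → Matrix ι₂ ι₂ ℂ)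
    (ψ : Wave) (ρ : Finset ℝ) :
    ∑ σ ∈ ρ.powerset, ‖actionKernel B₁ Q₁ L₁ R₁ T₁ B₂ Q₂ L₂ ψ σ (ρ \ σ)‖ ≤
      ∑ S ∈ ρ.powerset, entrySum B₁ * entrySum B₂ * (‖config ψ S‖ *
        (∏ t ∈ S, (entrySum (L₁ t) + entrySum (T₁ t) * entrySum (L₂ t))) *
        ∏ t ∈ ρ \ S, (entrySum (Q₁ t) + entrySum (Q₂ t) + entrySum (R₁ t) * entrySum (L₂ t))) := by
  have key := sum_orderedProd_mul (fun t => entrySum (Q₁ t)) (fun t => entrySum (L₁ t))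
    (fun t => entrySum (R₁ t)) (fun t => entrySum (T₁ t)) (fun t => entrySum (Q₂ t))
    (fun t => entrySum (L₂ t)) (fun _ _ _ _ => Commute.all _ _) (fun _ _ _ _ => Commute.all _ _) ρ
    (fun S => entrySum B₁ * entrySum B₂ * ‖config ψ S‖)
  have hR : ∀ S ∈ ρ.powerset, entrySum B₁ * entrySum B₂ * (‖config ψ S‖ *
      (∏ t ∈ S, (entrySum (L₁ t) + entrySum (T₁ t) * entrySum (L₂ t))) *
      ∏ t ∈ ρ \ S, (entrySum (Q₁ t) + entrySum (Q₂ t) + entrySum (R₁ t) * entrySum (L₂ t))) =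
      (entrySum B₁ * entrySum B₂ * ‖config ψ S‖) • orderedProd
        (pick S (fun t => entrySum (L₁ t) + entrySum (T₁ t) * entrySum (L₂ t))
          (fun t => entrySum (Q₁ t) + entrySum (Q₂ t) + entrySum (R₁ t) * entrySum (L₂ t))) ρ := by
    intro S hS
    conv_rhs => rw [← Finset.union_sdiff_of_subset (Finset.mem_powerset.1 hS)]
    rw [orderedProd_pick_union _ _ Finset.disjoint_sdiff, smul_eq_mul]
    ring
  rw [Finset.sum_congr rfl hR, ← key]
  refine Finset.sum_le_sum fun σ _ => (norm_sum_le _ _).trans (Finset.sum_le_sum fun S _ =>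
    (norm_sum_le _ _).trans (Finset.sum_le_sum fun U hU => ?_))
  have hd : Disjoint U (ρ \ σ) :=
    Finset.disjoint_of_subset_left (Finset.mem_powerset.1 hU) Finset.disjoint_sdiff
  rw [stateKernel, if_pos hd, norm_mul, norm_mul, RCLike.norm_conj]
  have b₁ := norm_trace_orderedProd_le B₁ (pickFour S U Q₁ L₁ R₁ T₁) σ
  have b₂ := norm_trace_orderedProd_le B₂ (pick U L₂ Q₂) (U ∪ (ρ \ σ))
  rw [entrySum_pickFour] at b₁
  rw [entrySum_pick] at b₂
  refine (mul_le_mul_of_nonneg_left (mul_le_mul b₁ b₂ (norm_nonneg _) ((norm_nonneg _).trans b₁))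
    (norm_nonneg _)).trans_eq ?_
  rw [smul_eq_mul]
  ring

theorem integrable_actionKernel (h₁ : OperatorTensors I Q₁ L₁ R₁ T₁)
    (h₂ : StateTensors I Q₂ L₂) (Ψ : Fock I) :
    Integrable (fun p : Configuration × Configuration =>
      actionKernel B₁ Q₁ L₁ R₁ T₁ B₂ Q₂ L₂ (wave Ψ) p.1.points p.2.points)
      ((configMeasure I).prod (configMeasure I)) := by
  have hm := aestronglyMeasurable_actionKernel B₁ B₂ h₁ h₂ Ψ
  have hℓ : MemLp (fun t => entrySum (L₁ t) + entrySum (T₁ t) * entrySum (L₂ t)) 2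
      (volume.restrict I) :=
    (memLp_entrySum h₁.1.2).add (MemLp.mul' (memLp_entrySum h₂.2) (memLp_entrySum h₁.2.2))
  have hq : MemLp (fun t => entrySum (Q₁ t) + entrySum (Q₂ t) + entrySum (R₁ t) * entrySum (L₂ t))
      1 (volume.restrict I) :=
    ((memLp_entrySum h₁.1.1).add (memLp_entrySum h₂.1)).add
      (MemLp.mul' (memLp_entrySum h₂.2) (memLp_entrySum h₁.2.1))
  set G : Finset ℝ → Finset ℝ → ℝ := fun α β => entrySum B₁ * entrySum B₂ *
    (‖config (wave Ψ) α‖ *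
      (∏ t ∈ α, (entrySum (L₁ t) + entrySum (T₁ t) * entrySum (L₂ t))) *
      ∏ t ∈ β, (entrySum (Q₁ t) + entrySum (Q₂ t) + entrySum (R₁ t) * entrySum (L₂ t))) with hG
  have hb : Integrable (fun p : Configuration × Configuration => G p.1.points p.2.points)
      ((configMeasure I).prod (configMeasure I)) :=
    (integrable_bound Ψ hℓ (memLp_one_iff_integrable.1 hq)).const_mul _
  refine ⟨hm, ?_⟩
  rw [HasFiniteIntegral, lintegral_enorm_split hm]
  -- The pairs `(σ, β)` are merged into `ρ`, bounded there by a sum over `S ⊆ ρ`, and split again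
  -- into the pairs `(S, ρ \ S)`, for which `G` is integrable.
  refine lt_of_le_of_lt (lintegral_mono fun ω => ?_)
    ((lintegral_enorm_split hb.1).symm.trans_lt hb.2)
  have hle := norm_actionKernel_le B₁ B₂ Q₁ L₁ R₁ T₁ Q₂ L₂ (wave Ψ) ω.points
  have hle' : ∑ σ ∈ ω.points.powerset,
      ‖actionKernel B₁ Q₁ L₁ R₁ T₁ B₂ Q₂ L₂ (wave Ψ) σ (ω.points \ σ)‖ ≤
      ∑ S ∈ ω.points.powerset, ‖G S (ω.points \ S)‖ :=
    hle.trans (Finset.sum_le_sum fun S _ => Real.le_norm_self _)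
  simp only [← ofReal_norm]
  rw [← ENNReal.ofReal_sum_of_nonneg fun _ _ => norm_nonneg _,
    ← ENNReal.ofReal_sum_of_nonneg fun _ _ => norm_nonneg _]
  exact ENNReal.ofReal_le_ofReal hle'

/-- The state's value at each `U` is itself an integral over its `Q₂`-points; as the sums over `S`
and `U` are finite, that integral can be taken outside. -/
theorem operatorIntegrand_stateVector_ae (Q₁ L₁ R₁ T₁ : ℝ → Matrix ι₁ ι₁ ℂ)
    (h₂ : StateTensors I Q₂ L₂) (ψ : Wave) (m : ℕ) :
    (fun x => operatorIntegrand B₁ Q₁ L₁ R₁ T₁ m x ψ (wave (stateVector B₂ h₂)))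
      =ᵐ[orderedMeasure I m] fun x => ∫ ω, actionKernel B₁ Q₁ L₁ R₁ T₁ B₂ Q₂ L₂ ψ
        (Finset.univ.image x) ω.points ∂(configMeasure I) := by
  -- Selecting coordinates pulls null sets back to null sets, and there are finitely many `U`, so
  -- one exceptional set serves for all sub-configurations.
  have hall : ∀ᵐ x ∂(cubeMeasure I m), ∀ U : Finset (Fin m),
      config (wave (stateVector B₂ h₂)) (U.image x) = stateConfig I B₂ Q₂ L₂ (U.image x) ∧
      Integrable (fun ω : Configuration => stateKernel B₂ Q₂ L₂ (U.image x) ω.points)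
        (configMeasure I) := by
    rw [ae_all_iff]
    intro U
    filter_upwards [(quasiMeasurePreserving_comp I (U.orderEmbOfFin rfl)
      (U.orderEmbOfFin rfl).injective).ae ((config_ofConfig_ae (memLp_stateConfig B₂ h₂)
        U.card).and (ae_configMeasure.1 (integrable_stateKernel_ae B₂ h₂) U.card))] with x hx
    rw [← image_comp_orderEmbOfFin]
    exact hx
  filter_upwards [ae_strictMono I m, ae_restrict_of_ae hall] with x hx hall'
  have hU : ∀ U ∈ (Finset.univ.image x).powerset,
      config (wave (stateVector B₂ h₂)) U = stateConfig I B₂ Q₂ L₂ U ∧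
      Integrable (fun ω : Configuration => stateKernel B₂ Q₂ L₂ U ω.points)
        (configMeasure I) := fun U hU => by
    rw [Finset.powerset_image] at hU
    obtain ⟨V, -, rfl⟩ := Finset.mem_image.1 hU
    exact hall' V
  rw [operatorIntegrand_eq _ _ _ _ _ hx]
  simp only [actionKernel]
  rw [integral_finsetSum _ fun S _ => integrable_finsetSum _ fun U h =>
    ((hU U h).2.const_mul _).const_mul _]
  refine Finset.sum_congr rfl fun S _ => ?_
  rw [integral_finsetSum _ fun U h => ((hU U h).2.const_mul _).const_mul _]
  refine Finset.sum_congr rfl fun U h => ?_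
  rw [integral_const_mul, integral_const_mul, (hU U h).1, stateConfig]
  ring

/-- A cMPO maps a cMPS to the cMPS with the product tensors. -/
theorem operatorAction_stateVector (h₁ : OperatorTensors I Q₁ L₁ R₁ T₁)
    (h₂ : StateTensors I Q₂ L₂) :
    OperatorAction I B₁ Q₁ L₁ R₁ T₁ (stateVector B₂ h₂)
      (stateVector (B₁ ⊗ₖ B₂) (stateTensors_kronecker h₁ h₂)) := by
  intro Ψ hΨ
  have hi := integrable_actionKernel B₁ B₂ h₁ h₂ Ψ
  -- Merging `σ` and `β` gives the Dyson series of the image state, with sum the integral of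
  -- `actionKernel` over pairs.
  have hstate : HasDysonSum I _ _ :=
    (hasDysonSum_split hi).congr_strictMono (F' := fun m x => stateIntegrand (B₁ ⊗ₖ B₂) _ _ m x
      (wave Ψ)) fun m x hx => by
        rw [stateIntegrand_eq _ _ _ hx, ← sum_trace_mul_trace]
        refine Finset.sum_congr rfl fun σ _ => Finset.sum_congr rfl fun S _ =>
          Finset.sum_congr rfl fun U hU => ?_
        rw [stateKernel, if_pos (Finset.disjoint_of_subset_left (Finset.mem_powerset.1 hU)
          Finset.disjoint_sdiff)]
  rw [(isCMPS_stateVector (B₁ ⊗ₖ B₂) (stateTensors_kronecker h₁ h₂) Ψ hΨ).2.unique hstate.2,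
    integral_prod _ hi]
  -- The same integral, iterated with `σ` outermost, is the Dyson series of the operator: the inner
  -- integral over `β` restores the wavefunction of the state.
  refine (hasDysonSum_of_integrable (f := fun σ => ∫ ω, actionKernel B₁ Q₁ L₁ R₁ T₁ B₂ Q₂ L₂
    (wave Ψ) σ ω.points ∂(configMeasure I)) hi.integral_prod_left).congr fun m => ?_
  exact (operatorIntegrand_stateVector_ae B₁ B₂ Q₁ L₁ R₁ T₁ h₂ (wave Ψ) m).symm

/-- A cMPS is the image of the vacuum under a cMPO. -/
theorem operatorAction_vacuum {ι : Type} [Fintype ι] [DecidableEq ι] {B : Matrix ι ι ℂ}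
    {Q L : ℝ → Matrix ι ι ℂ} (T : ℝ → Matrix ι ι ℂ) {Φ : Fock I} (h : IsCMPS I B Q L Φ) :
    OperatorAction I B Q L (fun _ => 0) T (vacuum I) Φ := by
  intro Ψ hΨ
  refine (h Ψ hΨ).congr fun m => ?_
  have h0 : ∀ n, ∀ᵐ x ∂(cubeMeasure I n), wave (vacuum I) n x = if n = 0 then 1 else 0 := by
    intro n
    rcases n with _ | n
    · have : (vacuum I 0 : Lp ℂ 2 (cubeMeasure I 0)) = (memLp_one_zero I).toLp _ := by
        rw [vacuum, lp.single_apply_self]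
      unfold wave
      rw [this]
      filter_upwards [(memLp_one_zero I).coeFn_toLp] with x hx
      simpa using hx
    · have : (vacuum I (n + 1) : Lp ℂ 2 (cubeMeasure I (n + 1))) = 0 := by
        rw [vacuum, lp.single_apply_ne _ _ _ (Nat.succ_ne_zero n)]
        rfl
      unfold wave
      rw [this]
      filter_upwards [Lp.coeFn_zero ℂ 2 (cubeMeasure I (n + 1))] with x hx
      simpa using hx
  have hall : ∀ᵐ x ∂(cubeMeasure I m), ∀ U : Finset (Fin m),
      wave (vacuum I) U.card (x ∘ U.orderEmbOfFin rfl) = if U.card = 0 then 1 else 0 := by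
    rw [ae_all_iff]
    intro U
    exact (quasiMeasurePreserving_comp I (U.orderEmbOfFin rfl)
      (U.orderEmbOfFin rfl).injective).ae (h0 U.card)
  filter_upwards [ae_strictMono I m, ae_restrict_of_ae hall] with x hx hall'
  have hU : ∀ U ∈ (Finset.univ.image x).powerset,
      config (wave (vacuum I)) U = if U = ∅ then 1 else 0 := fun U hU => by
    rw [Finset.powerset_image] at hU
    obtain ⟨V, -, rfl⟩ := Finset.mem_image.1 hU
    rw [config_image _ V hx, hall' V]
    by_cases hV : V = ∅
    · subst hV; simp
    · simp [hV]
  rw [operatorIntegrand_eq _ _ _ _ _ hx, stateIntegrand_eq _ _ _ hx]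
  refine Finset.sum_congr rfl fun S _ => ?_
  -- The vacuum vanishes on non-empty configurations, so only `U = ∅` survives, where `pickFour S ∅`
  -- involves just `L` and `Q`, whatever `T` is.
  rw [Finset.sum_eq_single_of_mem ∅ (Finset.empty_mem_powerset _) fun U hU' hne => by
    rw [hU U hU', if_neg hne, mul_zero, zero_mul], hU ∅ (Finset.empty_mem_powerset _), if_pos rfl,
    mul_one]
  congr 3

/-- Relabelling the bond indices. -/
theorem isCMPS_reindex {ι κ : Type} [Fintype ι] [DecidableEq ι] [Fintype κ] [DecidableEq κ]
    (e : ι ≃ κ) {B : Matrix ι ι ℂ} {Q L : ℝ → Matrix ι ι ℂ} {Φ : Fock I}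
    (h : IsCMPS I B Q L Φ) :
    IsCMPS I (Matrix.reindexAlgEquiv ℂ ℂ e B) (fun x => Matrix.reindexAlgEquiv ℂ ℂ e (Q x))
      (fun x => Matrix.reindexAlgEquiv ℂ ℂ e (L x)) Φ := by
  intro Ψ hΨ
  refine (h Ψ hΨ).congr_strictMono fun m x hx => ?_
  rw [stateIntegrand_eq _ _ _ hx, stateIntegrand_eq _ _ _ hx]
  refine Finset.sum_congr rfl fun S _ => ?_
  have e₁ : pick S (fun x => Matrix.reindexAlgEquiv ℂ ℂ e (L x))
      (fun x => Matrix.reindexAlgEquiv ℂ ℂ e (Q x)) =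
      fun t => Matrix.reindexAlgEquiv ℂ ℂ e (pick S L Q t) := by
    funext t
    simp only [pick]
    split_ifs <;> rfl
  rw [e₁, ← map_orderedProd, ← map_mul]
  congr 1
  simp only [Matrix.trace, Matrix.coe_reindexAlgEquiv, Matrix.diag, Matrix.reindex_apply,
    Matrix.submatrix_apply]
  exact (Equiv.sum_comp e.symm _).symm

theorem stateTensors_reindex {ι κ : Type} [Fintype ι] [DecidableEq ι] [Fintype κ] [DecidableEq κ]
    (e : ι ≃ κ) {Q L : ℝ → Matrix ι ι ℂ} (h : StateTensors I Q L) :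
    StateTensors I (fun x => Matrix.reindexAlgEquiv ℂ ℂ e (Q x))
      (fun x => Matrix.reindexAlgEquiv ℂ ℂ e (L x)) :=
  ⟨fun i j => h.1 (e.symm i) (e.symm j), fun i j => h.2 (e.symm i) (e.symm j)⟩

end Operator

end CMPO

end

/-! ### The main theorem -/

theorem mainTheorem2 (I : Set ℝ) (hI : I.OrdConnected) (D₁ D₂ : ℕ)
    (B₁ : Matrix (Fin D₁) (Fin D₁) ℂ) (Q₁ L₁ R₁ T₁ : ℝ → Matrix (Fin D₁) (Fin D₁) ℂ)
    (h₁ : CMPO.OperatorTensors I Q₁ L₁ R₁ T₁)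
    (B₂ : Matrix (Fin D₂) (Fin D₂) ℂ) (Q₂ L₂ : ℝ → Matrix (Fin D₂) (Fin D₂) ℂ)
    (h₂ : CMPO.StateTensors I Q₂ L₂) :
    -- the cMPS `|ψ[B₂,Q₂,L₂]⟩` is a well-defined vector of Fock space
    (∃! Φ : CMPO.Fock I, CMPO.IsCMPS I B₂ Q₂ L₂ Φ) ∧
    ∀ Φ : CMPO.Fock I, CMPO.IsCMPS I B₂ Q₂ L₂ Φ →
      -- it equals `O₂|Ω⟩` for the cMPO `O₂` with tensors `(B₂, Q₂, L₂, 0, 1)`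
      (CMPO.OperatorTensors I Q₂ L₂ (fun _ => 0) (fun _ => 1) ∧
        ∃ h : CMPO.vacuum I ∈ (CMPO.cMPO I B₂ Q₂ L₂ (fun _ => 0) (fun _ => 1)).domain,
          CMPO.cMPO I B₂ Q₂ L₂ (fun _ => 0) (fun _ => 1) ⟨CMPO.vacuum I, h⟩ = Φ) ∧
      ∃ h : Φ ∈ (CMPO.cMPO I B₁ Q₁ L₁ R₁ T₁).domain,
        -- `O₁` maps it to the cMPS with the stated tensors
        (CMPO.StateTensors I
            (fun x => Q₁ x ⊗ₖ (1 : Matrix (Fin D₂) (Fin D₂) ℂ) +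
              (1 : Matrix (Fin D₁) (Fin D₁) ℂ) ⊗ₖ Q₂ x + R₁ x ⊗ₖ L₂ x)
            (fun x => L₁ x ⊗ₖ (1 : Matrix (Fin D₂) (Fin D₂) ℂ) + T₁ x ⊗ₖ L₂ x) ∧
          CMPO.IsCMPS I (B₁ ⊗ₖ B₂)
            (fun x => Q₁ x ⊗ₖ (1 : Matrix (Fin D₂) (Fin D₂) ℂ) +
              (1 : Matrix (Fin D₁) (Fin D₁) ℂ) ⊗ₖ Q₂ x + R₁ x ⊗ₖ L₂ x)
            (fun x => L₁ x ⊗ₖ (1 : Matrix (Fin D₂) (Fin D₂) ℂ) + T₁ x ⊗ₖ L₂ x)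
            (CMPO.cMPO I B₁ Q₁ L₁ R₁ T₁ ⟨Φ, h⟩)) ∧
        -- in particular to a cMPS of bond dimension at most `D₁ D₂`
        ∃ D : ℕ, D ≤ D₁ * D₂ ∧ ∃ (B : Matrix (Fin D) (Fin D) ℂ)
          (Q L : ℝ → Matrix (Fin D) (Fin D) ℂ), CMPO.StateTensors I Q L ∧
            CMPO.IsCMPS I B Q L (CMPO.cMPO I B₁ Q₁ L₁ R₁ T₁ ⟨Φ, h⟩) := by
  have hmain : ∀ Φ : CMPO.Fock I, CMPO.IsCMPS I B₂ Q₂ L₂ Φ →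
      CMPO.OperatorAction I B₁ Q₁ L₁ R₁ T₁ Φ
        (CMPO.stateVector (B₁ ⊗ₖ B₂) (CMPO.stateTensors_kronecker h₁ h₂)) := fun Φ hΦ => by
    -- Finite-particle vectors separate points, so any vector representing the cMPS is the
    -- constructed `stateVector`.
    rw [hΦ.unique (CMPO.isCMPS_stateVector B₂ h₂)]
    exact CMPO.operatorAction_stateVector B₁ B₂ h₁ h₂
  refine ⟨⟨CMPO.stateVector B₂ h₂, CMPO.isCMPS_stateVector B₂ h₂,
    fun Φ hΦ => hΦ.unique (CMPO.isCMPS_stateVector B₂ h₂)⟩, fun Φ hΦ => ⟨⟨⟨h₂, ?_, ?_⟩, ?_⟩, ?_⟩⟩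
  · exact fun i j => MemLp.zero'
  · exact fun i j => memLp_top_const _
  · exact CMPO.cMPO_apply_eq_iff.2 (CMPO.operatorAction_vacuum _ hΦ)
  · obtain ⟨h, e⟩ := CMPO.cMPO_apply_eq_iff.2 (hmain Φ hΦ)
    have hK := CMPO.stateTensors_kronecker h₁ h₂
    have hS := CMPO.isCMPS_stateVector (B₁ ⊗ₖ B₂) hK
    rw [← e] at hS
    -- The pair index of the Kronecker tensors is relabelled by `Fin (D₁ * D₂)`; the trace is
    -- unaffected.
    exact ⟨h, ⟨hK, hS⟩, D₁ * D₂, le_rfl, _, _, _,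
      CMPO.stateTensors_reindex finProdFinEquiv hK, CMPO.isCMPS_reindex finProdFinEquiv hS⟩
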